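/- Let $\mathbb F_4=\{0,1,w,w^2\}$ with $w^2+w+1=0$. **Codes.** An additive $[n,\kappa/2,d]_4$ code is an additive subgroup $C\le\mathbb F_4^n$ with $2^\kappa$ elements (so $\log_4|C|=\kappa/2$) and minimum nonzero Hamming weight $d$. Its weight distribution is $1+\sum_{i=1}^nA_iz^i$, where $A_i$ is the number of codewords of weight $i$; it is a $t$-weight code if exactly $t$ of $A_1,\dots,A_n$ are nonzero. Put $g(\kappa,d)=\sum_{i=0}^{\kappa-1}\lceil d/2^i\rceil$. An additive $[n,\kappa/2,d]_4$ code is *Griesmer distance-optimal* (GDO) if $3n<g(\kappa,2d+2)$, and *Griesmer puncture-optimal* (GPO) if $3n+3<g(\kappa,2d+2)$, and there is no additive $[n+1,\kappa/2,d+1]_4$ code. A matrix over $\mathbb F_4$ generates the additive code that is the additive span of its rows; its generator multiset is the multiset of its columns. A multiset of columns generates the code (unique up to the order of coordinates) generated by any matrix having exactly these columns. **Matrices.** Let $k_1\ge3$ be odd, $k_2\ge4$ even, $k=k_1+k_2$. * Let $S$ be a $3\times7$ matrix over $\mathbb F_2$ whose columns are all the nonzero vectors of $\mathbb F_2^3$,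 let $f=f_0+f_1x+f_2x^2+x^3$ be irreducible over $\mathbb F_2$, let $A_f=\begin{pmatrix}0&1&0\\0&0&1\\f_0&f_1&f_2\end{pmatrix}$, and let $A_{3/2}=S+w\,A_fS$. For odd $j\ge3$ let $$A_{j/2+1}=\begin{pmatrix}A_{j/2}&A_{j/2}&A_{j/2}&A_{j/2}&0&0&0\\ \mathbf 0&\mathbf 1&\mathbf w&\mathbf w^{\mathbf 2}&1&w&w^2\\ \mathbf 0&\mathbf w&\mathbf w^{\mathbf 2}&\mathbf 1&w&w^2&1\end{pmatrix},$$ where bold entries denote constant rows of length $2^j-1$. This defines the $k_1\times(2^{k_1}-1)$ matrix $A_{k_1/2}$. * Let $l=k_2/2$, let $G$ be an $l$-row matrix over $\mathbb F_4$ whose columns are nonzero and represent every point of the projective space $PG(l-1,4)$ exactly once, and let $A_{k_2/2}=\begin{pmatrix}G&wG&w^2G\\wG&w^2G&G\end{pmatrix}$, a $k_2\times(2^{k_2}-1)$ matrix. * Let $\mathcal L$ be the multiset of the columns $\binom ab$ with $a$ a column of $(A_{k_1/2}\mid 0)$ and $b$ a column of $(A_{k_2/2}\mid0)$, with the column made of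 the two appended zero columns left out. Let $\mathcal L_1$ and $\mathcal L_2$ be the generator multisets of $\binom{A_{k_1/2}}{0}$ and $\binom{0}{A_{k_2/2}}$. **Theorem.** The multiset sum $\mathcal L_1+\mathcal L_2$ is contained in $\mathcal L$, and: 1. $\mathcal L\setminus\mathcal L_1$ generates an additive two-weight $[2^k-2^{k_1},\ \tfrac k2,\ 3\cdot2^{k-2}-3\cdot2^{k_1-2}]_4$ code with weight distribution $$1+(2^k-2^{k_2})z^{3\cdot2^{k-2}-3\cdot2^{k_1-2}}+(2^{k_2}-1)z^{3\cdot2^{k-2}}.$$ 2. The code in (1) is GDO if $k_1=3$, and GPO if $k_1\ge5$. 3. $\mathcal L\setminus(\mathcal L_1+\mathcal L_2)$ generates an additive three-weight $[2^k-2^{k_1}-2^{k_2}+1,\ \tfrac k2,\ 3\cdot2^{k-2}-3\cdot2^{k_1-2}-3\cdot2^{k_2-2}]_4$ code with weight distribution $$1+(2^k-2^{k_1}-2^{k_2}+1)z^{3\cdot2^{k-2}-3\cdot2^{k_1-2}-3\cdot2^{k_2-2}}+(2^{k_1}-1)z^{3\cdot2^{k-2}-3\cdot2^{k_1-2}}+(2^{k_2}-1)z^{3\cdot2^{k-2}-3\cdot2^{k_2-2}},$$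 and this code is GDO unless $(k_1,k_2)=(3,4)$. 4. The code in (3) is GDO if $|k_1-k_2|=1$ and $9\le k\le15$, or $|k_1-k_2|\ge3$ and $\min\{k_1,k_2\}\le4$; it is GPO if $|k_1-k_2|=1$ and $k\ge17$, or $|k_1-k_2|\ge3$ and $\min\{k_1,k_2\}>4$. -/

import Mathlib

noncomputable section

namespace QuaternaryAdditive

/-- The field of order four. -/
abbrev F4 : Type := GaloisField 2 2

/-! ### Additive codes, weights, parameters -/

open Classical in
/-- Hamming weight of a word over `F4`. -/
def wt {ι : Type*} [Fintype ι] (c : ι → F4) : ℕ := hammingNorm c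

/-- `C` is an additive `[n, κ/2, d]₄` code: an additive subgroup of `F4 ^ n` with `2 ^ κ` elements
(so that its dimension `log₄ |C|` is `κ / 2`) and minimum nonzero weight exactly `d`. -/
structure HasParams {ι : Type*} [Fintype ι] (C : AddSubgroup (ι → F4)) (n κ d : ℕ) : Prop where
  length : Fintype.card ι = n
  card : Nat.card C = 2 ^ κ
  minWeight : IsLeast {x : ℕ | ∃ c ∈ C, c ≠ 0 ∧ wt c = x} d

/-- `A_i`: the number of codewords of weight `i`. -/
def numWords {ι : Type*} [Fintype ι] (C : AddSubgroup (ι → F4)) (i : ℕ) : ℕ :=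
  Set.ncard {c : ι → F4 | c ∈ C ∧ wt c = i}

/-- The weight distribution `1 + A₁ z + ⋯ + Aₙ zⁿ`. -/
def weightDistribution {ι : Type*} [Fintype ι] (C : AddSubgroup (ι → F4)) : Polynomial ℕ :=
  1 + ∑ i ∈ Finset.Icc 1 (Fintype.card ι), Polynomial.C (numWords C i) * Polynomial.X ^ i

/-- `C` is a `t`-weight code: exactly `t` of `A₁, …, Aₙ` are nonzero. -/
def IsWeightCode {ι : Type*} [Fintype ι] (C : AddSubgroup (ι → F4)) (t : ℕ) : Prop :=
  Set.ncard {i : ℕ | 1 ≤ i ∧ i ≤ Fintype.card ι ∧ numWords C i ≠ 0} = t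

/-! ### Griesmer optimality -/

/-- `g(κ, d) = ∑_{i < κ} ⌈d / 2 ^ i⌉`. -/
def griesmer (κ d : ℕ) : ℕ := ∑ i ∈ Finset.range κ, ⌈(d : ℚ) / 2 ^ i⌉₊

/-- The additive `[n, κ/2, d]₄` code `C` is Griesmer distance-optimal: `3 n < g(κ, 2 d + 2)`. -/
def IsGDO {ι : Type*} [Fintype ι] (C : AddSubgroup (ι → F4)) (n κ d : ℕ) : Prop :=
  HasParams C n κ d ∧ 3 * n < griesmer κ (2 * d + 2)

/-- The additive `[n, κ/2, d]₄` code `C` is Griesmer puncture-optimal: `3 n + 3 < g(κ, 2 d + 2)`,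
and there is no additive `[n + 1, κ/2, d + 1]₄` code. -/
def IsGPO {ι : Type*} [Fintype ι] (C : AddSubgroup (ι → F4)) (n κ d : ℕ) : Prop :=
  HasParams C n κ d ∧ 3 * n + 3 < griesmer κ (2 * d + 2) ∧
    ¬ ∃ C' : AddSubgroup (Fin (n + 1) → F4), HasParams C' (n + 1) κ (d + 1)

/-! ### Generator matrices and generator multisets -/

/-- The additive code generated by the rows of a matrix. -/
def rowCode {ρ ι : Type*} (A : Matrix ρ ι F4) : AddSubgroup (ι → F4) :=
  AddSubgroup.closure (Set.range fun r : ρ => A r)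

/-- The generator multiset of a matrix: the multiset of its columns. -/
def columns {ρ ι : Type*} [Fintype ι] (A : Matrix ρ ι F4) : Multiset (ρ → F4) :=
  Finset.univ.val.map fun j : ι => fun r : ρ => A r j

open Classical in
/-- The difference `L \ L'` of multisets (with multiplicities). -/
def remove {α : Type*} (L L' : Multiset α) : Multiset α := L - L'

/-- `G` generates the simplex code over `K`: its columns are nonzero and represent every point of
the projective space exactly once. -/
def IsSimplexMatrix {K ρ ι : Type*} [Field K] (G : Matrix ρ ι K) : Prop :=
  (∀ j, (fun r => G r j) ≠ 0) ∧
    ∀ v : ρ → K, v ≠ 0 → ∃! j : ι, ∃ c : K, v = c • fun r => G r j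

/-! ### The three basic constructions -/

/-- The `κ × κ` companion matrix of a monic polynomial `f` of degree `κ` over the field of order
two: ones on the superdiagonal, and last row `(f₀, …, f_{κ-1})`. -/
def companion (κ : ℕ) (f : Polynomial (ZMod 2)) : Matrix (Fin κ) (Fin κ) (ZMod 2) :=
  Matrix.of fun i j =>
    if (i : ℕ) + 1 = κ then f.coeff j else if (j : ℕ) = (i : ℕ) + 1 then 1 else 0

/-- The matrix `S + w · (A_f S)` over `F4`, where `A_f` is the companion matrix of `f`. -/
def apsMatrix {κ : ℕ} {ι : Type*} (w : F4) (f : Polynomial (ZMod 2))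
    (S : Matrix (Fin κ) ι (ZMod 2)) : Matrix (Fin κ) ι F4 :=
  S.map (algebraMap (ZMod 2) F4) + w • (companion κ f * S).map (algebraMap (ZMod 2) F4)

/-- One step of the iteration, two more rows: from `A` to
```
A  A  A   A   0  0   0
0  1  w   w²  1  w   w²
0  w  w²  1   w  w²  1
```
The columns of the first four blocks are indexed by `Fin 4 × ι`, the last three by `Fin 3`. -/
def iterStep {ρ ι : Type*} (w : F4) (A : Matrix ρ ι F4) :
    Matrix (ρ ⊕ Fin 2) ((Fin 4 × ι) ⊕ Fin 3) F4 :=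
  Matrix.fromBlocks
    (A.submatrix id Prod.snd)
    0
    ((!![0, 1, w, w ^ 2; 0, w, w ^ 2, 1] : Matrix (Fin 2) (Fin 4) F4).submatrix id Prod.fst)
    !![1, w, w ^ 2; w, w ^ 2, 1]

/-- Row indices after `m` steps of the iteration: `3 + 2 m` of them. -/
def OddRow : ℕ → Type
  | 0 => Fin 3
  | m + 1 => OddRow m ⊕ Fin 2

/-- Column indices after `m` steps of the iteration: `2 ^ (3 + 2 m) - 1` of them. -/
def OddCol : ℕ → Type
  | 0 => Fin 7
  | m + 1 => (Fin 4 × OddCol m) ⊕ Fin 3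

instance OddCol.instFintype : (m : ℕ) → Fintype (OddCol m)
  | 0 => inferInstanceAs (Fintype (Fin 7))
  | m + 1 =>
    haveI := OddCol.instFintype m
    inferInstanceAs (Fintype ((Fin 4 × OddCol m) ⊕ Fin 3))

/-- The matrix with `3 + 2 m` rows obtained from the `3 × 7` matrix `A` by `m` iterations. -/
def oddMatrix (w : F4) (A : Matrix (Fin 3) (Fin 7) F4) : (m : ℕ) → Matrix (OddRow m) (OddCol m) F4
  | 0 => A
  | m + 1 => iterStep w (oddMatrix w A m)

/-- The matrix with `2 l` rows obtained from the `l`-row matrix `G`: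
```
G    w G   w² G
w G  w² G  G
```
-/
def evenMatrix {ρ ι : Type*} (w : F4) (G : Matrix ρ ι F4) : Matrix (ρ ⊕ ρ) (ι ⊕ ι ⊕ ι) F4 :=
  Matrix.fromRows
    (Matrix.fromCols G (Matrix.fromCols (w • G) (w ^ 2 • G)))
    (Matrix.fromCols (w • G) (Matrix.fromCols (w ^ 2 • G) G))

/-! ### The combined code and its anticodes -/

/-- `A° = (A | 0)`: append a zero column (indexed by `none`). -/
def addZeroCol {ρ ι : Type*} (A : Matrix ρ ι F4) : Matrix ρ (Option ι) F4 :=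
  Matrix.of fun r j => j.elim 0 (A r)

/-- `A ⋆ B`: the columns are all `(a, b)` with `a` a column of `A` and `b` a column of `B`. -/
def star {ρ₁ ρ₂ ι₁ ι₂ : Type*} (A : Matrix ρ₁ ι₁ F4) (B : Matrix ρ₂ ι₂ F4) :
    Matrix (ρ₁ ⊕ ρ₂) (ι₁ × ι₂) F4 :=
  Matrix.fromRows (A.submatrix id Prod.fst) (B.submatrix id Prod.snd)

/-- `A° ⋆ B°` with its last column, which is zero, deleted. -/
def combined {ρ₁ ρ₂ ι₁ ι₂ : Type*} (A : Matrix ρ₁ ι₁ F4) (B : Matrix ρ₂ ι₂ F4) :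
    Matrix (ρ₁ ⊕ ρ₂) {p : Option ι₁ × Option ι₂ // p ≠ (none, none)} F4 :=
  (star (addZeroCol A) (addZeroCol B)).submatrix id Subtype.val

open Classical in
/-- The generator multiset of the combined code. -/
def combinedColumns {ρ₁ ρ₂ ι₁ ι₂ : Type*} [Fintype ι₁] [Fintype ι₂]
    (A : Matrix ρ₁ ι₁ F4) (B : Matrix ρ₂ ι₂ F4) : Multiset (ρ₁ ⊕ ρ₂ → F4) :=
  columns (combined A B)

/-- The generator multiset of the anticode `(A ; 0)`. -/
def upperColumns {ρ₁ ι₁ : Type*} (ρ₂ : Type*) [Fintype ι₁] (A : Matrix ρ₁ ι₁ F4) :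
    Multiset (ρ₁ ⊕ ρ₂ → F4) :=
  columns (Matrix.fromRows A (0 : Matrix ρ₂ ι₁ F4))

/-- The generator multiset of the anticode `(0 ; B)`. -/
def lowerColumns (ρ₁ : Type*) {ρ₂ ι₂ : Type*} [Fintype ι₂] (B : Matrix ρ₂ ι₂ F4) :
    Multiset (ρ₁ ⊕ ρ₂ → F4) :=
  columns (Matrix.fromRows (0 : Matrix ρ₁ ι₂ F4) B)

end QuaternaryAdditive

end

/-!
A codeword of the additive code generated by a matrix is determined by a vector `u` over `ZMod 2`
choosing the rows to be added, and its weight is the number of columns, counted with multiplicity,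
at which the combination `u` of the rows does not vanish. Hence removing a submultiset of columns
subtracts weights, and everything reduces to the weights of the three matrices involved.

* The matrix with `k₁` rows has constant weight `3 * 2 ^ (k₁ - 2)` (`wt_encode_oddMatrix`). For
  three rows, a column is `x + w * A_f x` with `x` running through the nonzero vectors, and `u`,
  `A_fᵀ u` are linearly independent because `f` is irreducible (`wt_encode_apsMatrix`). In one
  iteration, a combination that involves the two new rows takes the values `x + z * t`,
  with `z ≠ 0` and `t` running through the field, on the four copies of a column, and exactly three
  of them are nonzero (`wt_encode_iterStep`).
* The columns of the matrix with `k₂` rows, together with the zero column, correspond to all vectors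
  of `F4 ^ l`, and a combination of rows evaluates to a linear form there. So a nonzero combination
  takes each value of `F4` equally often (`wt_add_encode_evenMatrix`).
* By this equidistribution, the combined code has constant weight `3 * 2 ^ (k - 2)`: the value on a
  column `(a, b)` is the sum of a value at `a` and a value at `b`
  (`msWeight_combinedColumns_left`, `msWeight_combinedColumns_right`).

After the removal, the weight of a combination depends only on which of its two parts vanish, and
this gives parameters and weight distribution (`hasParams_of_weights`,
`weightDistribution_of_weights`).

The inequalities on `griesmer k (2 * d + 2)` follow from the recursion
`griesmer (κ + 1) d = d + griesmer κ ⌈d / 2⌉` (`griesmer_removeOne`, `griesmer_removeBoth`).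
The nonexistence part of puncture-optimality is the Griesmer bound `3 * n ≥ griesmer κ (2 * d)`
for additive codes (`HasParams.griesmer_le`): replacing each coordinate by its three nonzero binary
functionals turns an additive `[n, κ/2, d]₄` code into a binary linear `[3 n, κ, 2 d]` code, for
which the bound is proved by passing to residual codes (`griesmer_le_card`).
-/

noncomputable section

open Polynomial

namespace QuaternaryAdditive

/-! ### Encoding by combinations of rows -/

lemma zmod_two_cases (x : ZMod 2) : x = 0 ∨ x = 1 := by
  revert x; decide

/-- The entry, at a column `c`, of the combination of rows with coefficients `u`. -/
def evalCol {ρ : Type*} [Fintype ρ] (u : ρ → ZMod 2) (c : ρ → F4) : F4 := ∑ r, u r • c r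

section Encoding
variable {ρ : Type*} [Fintype ρ]

lemma evalCol_add_left (u v : ρ → ZMod 2) (c : ρ → F4) :
    evalCol (u + v) c = evalCol u c + evalCol v c := by
  simp [evalCol, add_smul, Finset.sum_add_distrib]

@[simp] lemma evalCol_zero_left (c : ρ → F4) : evalCol 0 c = 0 := by
  simp [evalCol]

@[simp] lemma evalCol_zero_right (u : ρ → ZMod 2) : evalCol u 0 = 0 := by
  simp [evalCol]

lemma evalCol_sumElim {ρ₁ ρ₂ : Type*} [Fintype ρ₁] [Fintype ρ₂]
    (u : ρ₁ ⊕ ρ₂ → ZMod 2) (c : ρ₁ ⊕ ρ₂ → F4) :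
    evalCol u c = evalCol (u ∘ Sum.inl) (c ∘ Sum.inl) + evalCol (u ∘ Sum.inr) (c ∘ Sum.inr) := by
  simp [evalCol]

/-- The word obtained by combining the rows of `A` with coefficients in the prime field. -/
def encode {ι : Type*} (A : Matrix ρ ι F4) : (ρ → ZMod 2) →+ (ι → F4) where
  toFun u j := evalCol u fun r => A r j
  map_zero' := by ext; simp
  map_add' u v := by ext; simp [evalCol_add_left]

lemma rowCode_eq_range {ι : Type*} (A : Matrix ρ ι F4) : rowCode A = (encode A).range := by
  classical
  apply le_antisymm
  · rw [rowCode, AddSubgroup.closure_le]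
    rintro _ ⟨r, rfl⟩
    refine ⟨Pi.single r 1, ?_⟩
    ext j
    simp [encode, evalCol, Pi.single_apply, ite_smul]
  · rintro _ ⟨u, rfl⟩
    have h : encode A u = ∑ r, u r • A r := by
      ext j; simp [encode, evalCol]
    rw [h]
    refine AddSubgroup.sum_mem _ fun r _ => ?_
    rcases zmod_two_cases (u r) with h2 | h2
    · rw [h2, zero_smul]; exact zero_mem _
    · rw [h2, one_smul]; exact AddSubgroup.subset_closure ⟨r, rfl⟩

open Classical in
/-- The weight of the combination `u` in the code with generator multiset `M`: the number of columns
in `M`, with multiplicity, at which it does not vanish. -/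
def msWeight (M : Multiset (ρ → F4)) (u : ρ → ZMod 2) : ℕ := M.countP fun c => evalCol u c ≠ 0

lemma msWeight_columns {ι : Type*} [Fintype ι] (A : Matrix ρ ι F4) (u : ρ → ZMod 2) :
    msWeight (columns A) u = wt (encode A u) := by
  classical
  rw [msWeight, columns, Multiset.countP_map, wt, hammingNorm, Finset.card, Finset.filter_val]
  congr!

lemma msWeight_remove {L M : Multiset (ρ → F4)} (h : M ≤ L) (u : ρ → ZMod 2) :
    msWeight (remove L M) u = msWeight L u - msWeight M u := by
  classical
  unfold msWeight remove
  convert Multiset.countP_sub h _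

lemma card_remove {α : Type*} {L M : Multiset α} (h : M ≤ L) :
    Multiset.card (remove L M) = Multiset.card L - Multiset.card M := by
  classical
  unfold remove
  convert Multiset.card_sub h

lemma msWeight_add (L M : Multiset (ρ → F4)) (u : ρ → ZMod 2) :
    msWeight (L + M) u = msWeight L u + msWeight M u := by
  classical
  exact Multiset.countP_add _ _ _

omit [Fintype ρ] in
lemma card_columns {ι : Type*} [Fintype ι] (A : Matrix ρ ι F4) :
    Multiset.card (columns A) = Fintype.card ι := by
  simp [columns]

lemma wt_eq_zero {ι : Type*} [Fintype ι] (c : ι → F4) : wt c = 0 ↔ c = 0 := by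
  classical
  simp [wt]

lemma wt_le {ι : Type*} [Fintype ι] (c : ι → F4) : wt c ≤ Fintype.card ι := by
  classical
  simpa [wt] using hammingNorm_le_card_fintype

variable {ι : Type*} [Fintype ι] {A : Matrix ρ ι F4}

lemma encode_injective (h : ∀ u ≠ 0, 0 < wt (encode A u)) : Function.Injective (encode A) := by
  rw [injective_iff_map_eq_zero]
  intro u hu
  by_contra h0
  have := h u h0
  rw [hu, (wt_eq_zero _).2 rfl] at this
  exact this.false

lemma numWords_rowCode [DecidableEq ρ] (h : ∀ u ≠ 0, 0 < wt (encode A u)) (i : ℕ) :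
    numWords (rowCode A) i =
      (Finset.univ.filter fun u : ρ → ZMod 2 => wt (encode A u) = i).card := by
  have : {c : ι → F4 | c ∈ rowCode A ∧ wt c = i} =
      encode A '' (Finset.univ.filter fun u : ρ → ZMod 2 => wt (encode A u) = i) := by
    ext c
    rw [rowCode_eq_range]
    constructor
    · rintro ⟨⟨u, rfl⟩, hu⟩
      exact ⟨u, by simpa using hu, rfl⟩
    · rintro ⟨u, hu, rfl⟩
      exact ⟨⟨u, rfl⟩, by simpa using hu⟩
  rw [numWords, this, Set.ncard_image_of_injective _ (encode_injective h), Set.ncard_coe_finset]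

lemma weightDistribution_rowCode [DecidableEq ρ] (h : ∀ u ≠ 0, 0 < wt (encode A u)) :
    weightDistribution (rowCode A) = ∑ u : ρ → ZMod 2, X ^ wt (encode A u) := by
  rw [← Finset.sum_fiberwise_of_maps_to (s := Finset.univ) (t := Finset.range (Fintype.card ι + 1))
    (g := fun u => wt (encode A u)) (fun u _ => by
      rw [Finset.mem_range]; exact Nat.lt_succ_of_le (wt_le _)), Finset.range_eq_Ico,
    Finset.sum_eq_sum_Ico_succ_bot (Nat.succ_pos _), weightDistribution]
  have h0 : (Finset.univ.filter fun u : ρ → ZMod 2 => wt (encode A u) = 0) = {0} := by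
    ext u
    simp only [Finset.mem_filter, Finset.mem_univ, true_and, Finset.mem_singleton]
    constructor
    · intro hu
      by_contra h0
      exact (h u h0).ne' hu
    · rintro rfl
      rw [map_zero, wt_eq_zero]
  congr 1
  · rw [h0]; simp [(wt_eq_zero (0 : ι → F4)).2 rfl]
  · refine Finset.sum_congr rfl fun i _ => ?_
    rw [numWords_rowCode h, Finset.sum_congr rfl (g := fun _ => X ^ i)
      (fun u hu => by rw [(Finset.mem_filter.1 hu).2]), Finset.sum_const, nsmul_eq_mul]
    simp

lemma numWords_eq_coeff (C : AddSubgroup (ι → F4)) {i : ℕ} (h1 : 1 ≤ i)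
    (h2 : i ≤ Fintype.card ι) : numWords C i = (weightDistribution C).coeff i := by
  have h0 : i ≠ 0 := by omega
  simp [weightDistribution, coeff_one, h0, h1, h2, coeff_X_pow]

lemma hasParams_rowCode {d : ℕ} (h0 : 0 < d) (h : ∀ u ≠ 0, d ≤ wt (encode A u))
    (hd : ∃ u, wt (encode A u) = d) :
    HasParams (rowCode A) (Fintype.card ι) (Fintype.card ρ) d := by
  have hinj := encode_injective (fun u hu => h0.trans_le (h u hu))
  refine ⟨rfl, ?_, ?_, ?_⟩
  · classical
    rw [rowCode_eq_range, ← Nat.card_congr (AddMonoidHom.ofInjective hinj).toEquiv]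
    simp
  · obtain ⟨u, hu⟩ := hd
    refine ⟨encode A u, by rw [rowCode_eq_range]; exact ⟨u, rfl⟩, ?_, hu⟩
    rw [Ne, ← wt_eq_zero]; omega
  · rintro _ ⟨c, hc, hc0, rfl⟩
    rw [rowCode_eq_range] at hc
    obtain ⟨u, rfl⟩ := hc
    exact h u (by rintro rfl; exact hc0 (map_zero _))

end Encoding

/-! ### Weights of words on composite index types -/

section WeightSums

open Classical in
lemma wt_eq_sum {ι : Type*} [Fintype ι] (c : ι → F4) :
    wt c = ∑ j, if c j ≠ 0 then 1 else 0 := by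
  rw [wt, hammingNorm, Finset.card_filter]

lemma wt_sum {ι κ : Type*} [Fintype ι] [Fintype κ] (c : ι ⊕ κ → F4) :
    wt c = wt (c ∘ Sum.inl) + wt (c ∘ Sum.inr) := by
  classical
  simp only [wt_eq_sum, Fintype.sum_sum_type, Function.comp_apply]

lemma wt_option {ι : Type*} [Fintype ι] (c : Option ι → F4) (h : c none = 0) :
    wt c = wt (c ∘ some) := by
  classical
  simp [wt_eq_sum, Fintype.sum_option, h]

lemma wt_prod {ι κ : Type*} [Fintype ι] [Fintype κ] (c : ι × κ → F4) :
    wt c = ∑ i, wt fun j => c (i, j) := by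
  classical
  simp only [wt_eq_sum, Fintype.sum_prod_type]

lemma wt_prod_right {ι κ : Type*} [Fintype ι] [Fintype κ] (c : ι × κ → F4) :
    wt c = ∑ j, wt fun i => c (i, j) := by
  classical
  simp only [wt_eq_sum, Fintype.sum_prod_type_right]

lemma wt_comp_bijective {ι κ : Type*} [Fintype ι] [Fintype κ] (c : κ → F4) {e : ι → κ}
    (he : Function.Bijective e) : wt (c ∘ e) = wt c := by
  classical
  simp only [wt_eq_sum, Function.comp_apply]
  exact he.sum_comp fun j => if c j ≠ 0 then 1 else 0

lemma wt_subtype {ι : Type*} [Fintype ι] (p : ι → Prop) [Fintype {i // p i}] (c : ι → F4)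
    (h : ∀ i, ¬ p i → c i = 0) : wt (fun i : {i // p i} => c i) = wt c := by
  classical
  rw [wt_eq_sum, wt_eq_sum, ← Finset.sum_subtype (Finset.univ.filter p) (by simp)
    (fun i => if c i ≠ 0 then 1 else 0), Finset.sum_filter]
  refine Finset.sum_congr rfl fun i _ => ?_
  split_ifs <;> simp_all

end WeightSums

/-! ### Arithmetic in the field of order four -/

section FieldFour

lemma natCard_F4 : Nat.card F4 = 4 := GaloisField.card 2 2 (by norm_num)

variable {w : F4} (hw : w ^ 2 + w + 1 = 0)
include hw

lemma root_cube : w ^ 3 = 1 := by linear_combination (w - 1) * hw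

lemma root_ne_zero : w ≠ 0 := by rintro rfl; simp at hw

lemma root_ne_one : w ≠ 1 := by
  rintro rfl
  have : (1 : F4) = 0 := by
    linear_combination hw - CharTwo.add_self_eq_zero (1 : F4)
  exact one_ne_zero this

/-- The entries of the new rows in one step of the iteration run through the whole field. -/
lemma powers_bijective : Function.Bijective (![0, 1, w, w ^ 2] : Fin 4 → F4) := by
  have h0 := root_ne_zero hw
  have h1 := root_ne_one hw
  have h2 : w ^ 2 ≠ 1 := fun h => h1 (by linear_combination root_cube hw - w * h)
  have h3 : w ^ 2 ≠ w := fun h => h1 (mul_left_cancel₀ h0 (by linear_combination h))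
  have h4 : w ^ 2 ≠ 0 := pow_ne_zero 2 h0
  refine Function.Injective.bijective_of_nat_card_le ?_ (by simp [natCard_F4])
  intro i j hij
  fin_cases i <;> fin_cases j <;>
    first
    | rfl
    | (exfalso; simp [h0, h1, h2, h3, h0.symm, h1.symm, h2.symm, h3.symm, h4.symm] at hij)

/-- `1` and `w` are linearly independent over the prime field. -/
lemma coords_ne_zero {a b : ZMod 2} (h : ¬ (a = 0 ∧ b = 0)) :
    algebraMap (ZMod 2) F4 a + algebraMap (ZMod 2) F4 b * w ≠ 0 := by
  have h0 := root_ne_zero hw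
  have h1 := root_ne_one hw
  rcases zmod_two_cases a with rfl | rfl <;> rcases zmod_two_cases b with rfl | rfl
  · simp at h
  · simpa
  · simp
  · simp only [map_one, one_mul]
    intro h2
    exact h1 (by linear_combination h2 - CharTwo.add_self_eq_zero (1 : F4))

end FieldFour

lemma wt_bijective {ι : Type*} [Fintype ι] {c : ι → F4} (hc : Function.Bijective c) :
    wt c = 3 := by
  classical
  let _ := Fintype.ofFinite F4
  have h4 : Fintype.card F4 = 4 := by rw [← Nat.card_eq_fintype_card]; exact natCard_F4
  have := wt_comp_bijective (fun x : F4 => x) hc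
  rw [show (fun x : F4 => x) ∘ c = c from rfl] at this
  rw [this, wt, hammingNorm, Finset.filter_ne' , Finset.card_erase_of_mem (Finset.mem_univ _),
    Finset.card_univ, h4]

/-! ### The matrices with an odd number of rows -/

section Odd
variable {ρ ι : Type*} [Fintype ρ] [Fintype ι]

lemma wt_encode_iterStep {w : F4} (hw : w ^ 2 + w + 1 = 0) (A : Matrix ρ ι F4)
    (u : ρ ⊕ Fin 2 → ZMod 2) :
    wt (encode (iterStep w A) u) =
      if u ∘ Sum.inr = 0 then 4 * wt (encode A (u ∘ Sum.inl)) else 3 * (Fintype.card ι + 1) := by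
  classical
  set z : F4 := algebraMap (ZMod 2) F4 (u (.inr 0)) + algebraMap (ZMod 2) F4 (u (.inr 1)) * w
    with hz
  have e1 : ∀ i j, encode (iterStep w A) u (.inl (i, j)) =
      encode A (u ∘ Sum.inl) j + z * (![0, 1, w, w ^ 2] : Fin 4 → F4) i := by
    intro i j
    have h3 := root_cube hw
    simp only [encode, AddMonoidHom.coe_mk, ZeroHom.coe_mk, evalCol_sumElim]
    congr 1
    simp only [evalCol, Fin.sum_univ_two, iterStep, hz, Algebra.smul_def, Function.comp_apply,
      Matrix.fromBlocks_apply₂₁, Matrix.submatrix_apply]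
    fin_cases i <;> simp
    · ring
    · linear_combination (-algebraMap (ZMod 2) F4 (u (.inr 1))) * h3
  have e2 : ∀ i, encode (iterStep w A) u (.inr i) =
      z * (![0, 1, w, w ^ 2] : Fin 4 → F4) i.succ := by
    intro i
    have h3 := root_cube hw
    simp only [encode, AddMonoidHom.coe_mk, ZeroHom.coe_mk, evalCol_sumElim]
    simp only [evalCol, Fin.sum_univ_two, iterStep, hz, Algebra.smul_def, Function.comp_apply,
      Matrix.fromBlocks_apply₂₂, Matrix.fromBlocks_apply₁₂]
    fin_cases i <;> simp
    · ring
    · linear_combination (-algebraMap (ZMod 2) F4 (u (.inr 1))) * h3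
  rw [wt_sum]
  split_ifs with h
  · have hz0 : z = 0 := by
      have h0 := congrFun h 0
      have h1 := congrFun h 1
      simp only [Function.comp_apply, Pi.zero_apply] at h0 h1
      simp [hz, h0, h1]
    have f2 : encode (iterStep w A) u ∘ Sum.inr = 0 := by
      ext i; simp [e2, hz0]
    rw [f2, (wt_eq_zero _).2 rfl, wt_prod]
    simp only [Function.comp_apply, e1, hz0, zero_mul, add_zero]
    simp
  · have hz0 : z ≠ 0 := by
      refine coords_ne_zero hw fun h' => h ?_
      ext i
      fin_cases i
      · exact h'.1
      · exact h'.2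
    have hb : ∀ x : F4, Function.Bijective fun i => x + z * (![0, 1, w, w ^ 2] : Fin 4 → F4) i :=
      fun x => ((AddGroup.addLeft_bijective x).comp (mulLeft_bijective₀ z hz0)).comp
        (powers_bijective hw)
    have f1 : ∀ j, wt (fun i => (encode (iterStep w A) u ∘ Sum.inl) (i, j)) = 3 := by
      intro j
      simp only [Function.comp_apply, e1]
      exact wt_bijective (hb _)
    have f2 : wt (encode (iterStep w A) u ∘ Sum.inr) = 3 := by
      have := wt_bijective (hb 0)
      rw [wt_eq_sum, Fin.sum_univ_succ] at this
      rw [wt_eq_sum]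
      simpa [e2] using this
    rw [wt_prod_right, Finset.sum_congr rfl fun j _ => f1 j, f2]
    simp; ring

lemma card_iterCol : Fintype.card ((Fin 4 × ι) ⊕ Fin 3) + 1 = 4 * (Fintype.card ι + 1) := by
  simp; ring

instance OddRow.instFintype : (m : ℕ) → Fintype (OddRow m)
  | 0 => inferInstanceAs (Fintype (Fin 3))
  | m + 1 =>
    haveI := OddRow.instFintype m
    inferInstanceAs (Fintype (OddRow m ⊕ Fin 2))

lemma card_oddRow (m : ℕ) : Fintype.card (OddRow m) = 2 * m + 3 := by
  induction m with
  | zero => rfl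
  | succ m ih =>
    have : Fintype.card (OddRow (m + 1)) = Fintype.card (OddRow m ⊕ Fin 2) := rfl
    rw [this, Fintype.card_sum, ih, Fintype.card_fin]; ring

lemma card_oddCol (m : ℕ) : Fintype.card (OddCol m) + 1 = 8 * 4 ^ m := by
  induction m with
  | zero => rfl
  | succ m ih =>
    have : Fintype.card (OddCol (m + 1)) = Fintype.card ((Fin 4 × OddCol m) ⊕ Fin 3) := rfl
    rw [this, card_iterCol, ih]; ring

lemma wt_encode_oddMatrix {w : F4} (hw : w ^ 2 + w + 1 = 0) {A : Matrix (Fin 3) (Fin 7) F4}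
    (hA : ∀ u ≠ 0, wt (encode A u) = 6) (m : ℕ) :
    ∀ u ≠ 0, wt (encode (oddMatrix w A m) u) = 6 * 4 ^ m := by
  induction m with
  | zero => intro u hu; exact hA u hu
  | succ m ih =>
    intro u hu
    have h := wt_encode_iterStep hw (oddMatrix w A m) u
    refine h.trans ?_
    split_ifs with h0
    · rw [ih, pow_succ]; ring
      intro h1
      refine hu (funext fun i => ?_)
      rcases i with i | i
      · exact congrFun h1 i
      · exact congrFun h0 i
    · rw [card_oddCol, pow_succ]; ring

end Odd

section Base

/-- With `f = 1 + f₁ x + (1 + f₁) x² + x³`, the two linear forms are `u` and `A_fᵀ u`. -/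
lemma wt_companion_aux : ∀ (f1 : ZMod 2) (u : Fin 3 → ZMod 2), u ≠ 0 →
    (Finset.univ.filter fun x : Fin 3 → ZMod 2 =>
      u 0 * x 0 + u 1 * x 1 + u 2 * x 2 ≠ 0 ∨
      u 0 * x 1 + u 1 * x 2 + u 2 * (x 0 + f1 * x 1 + (1 + f1) * x 2) ≠ 0).card = 6 := by
  decide +kernel

/-- An irreducible cubic over the field of order two has neither `0` nor `1` as a root. -/
lemma coeff_of_irreducible {f : (ZMod 2)[X]} (hf : Irreducible f) (hm : f.Monic)
    (hd : f.natDegree = 3) : f.coeff 0 = 1 ∧ f.coeff 2 = 1 + f.coeff 1 := by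
  have hr : ∀ a, f.eval a ≠ 0 := fun a ha =>
    hf.not_isRoot_of_natDegree_ne_one (by omega) ha
  have h3 : f.coeff 3 = 1 := by rw [← hd]; exact hm
  have h0 := hr 0
  have h1 := hr 1
  rw [eval_eq_sum_range, hd] at h0 h1
  simp [Finset.sum_range_succ, h3] at h0 h1
  generalize f.coeff 0 = a at *
  generalize f.coeff 1 = b at *
  generalize f.coeff 2 = c at *
  clear h3 hr
  revert a b c
  decide

lemma wt_encode_apsMatrix {w : F4} (hw : w ^ 2 + w + 1 = 0) {S : Matrix (Fin 3) (Fin 7) (ZMod 2)}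
    (hS : IsSimplexMatrix S) {f : (ZMod 2)[X]} (hm : f.Monic) (hf : Irreducible f)
    (hd : f.natDegree = 3) : ∀ u ≠ 0, wt (encode (apsMatrix w f S) u) = 6 := by
  intro u hu
  obtain ⟨c0, c2⟩ := coeff_of_irreducible hf hm hd
  classical
  have hval : ∀ j, encode (apsMatrix w f S) u j =
      algebraMap (ZMod 2) F4 (u 0 * S 0 j + u 1 * S 1 j + u 2 * S 2 j) +
      algebraMap (ZMod 2) F4 (u 0 * S 1 j + u 1 * S 2 j +
        u 2 * (S 0 j + f.coeff 1 * S 1 j + (1 + f.coeff 1) * S 2 j)) * w := by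
    intro j
    simp [encode, evalCol, Fin.sum_univ_three, apsMatrix, companion, Matrix.mul_apply, c0, c2,
      Algebra.smul_def]
    ring
  have hne : ∀ j, encode (apsMatrix w f S) u j ≠ 0 ↔
      (u 0 * S 0 j + u 1 * S 1 j + u 2 * S 2 j ≠ 0 ∨ u 0 * S 1 j + u 1 * S 2 j +
        u 2 * (S 0 j + f.coeff 1 * S 1 j + (1 + f.coeff 1) * S 2 j) ≠ 0) := by
    intro j
    rw [hval, ← not_and_or]
    refine ⟨fun h h' => h ?_, coords_ne_zero hw⟩
    rw [h'.1, h'.2]; simp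
  rw [← wt_companion_aux (f.coeff 1) u hu, wt, hammingNorm]
  refine Finset.card_bij (fun j _ r => S r j) ?_ ?_ ?_
  · intro j hj
    simpa [hne] using hj
  · intro j _ j' _ hjj
    obtain ⟨_, _, hu2⟩ := hS.2 _ (hS.1 j)
    rw [hu2 j ⟨1, by simp⟩, hu2 j' ⟨1, by simpa using hjj⟩]
  · intro x hx
    have hx0 : x ≠ 0 := by
      rintro rfl
      simp at hx
    obtain ⟨j, ⟨c, hc⟩, _⟩ := hS.2 x hx0
    have hxj : x = fun r => S r j := by
      rcases zmod_two_cases c with rfl | rfl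
      · simp at hc; exact absurd hc hx0
      · simpa using hc
    refine ⟨j, ?_, hxj.symm⟩
    subst hxj
    simpa [hne] using hx

end Base

/-! ### The matrices with an even number of rows -/

section Even
variable {ρ ι : Type*} [Fintype ρ]

/-- The columns of `evenMatrix w G` with the zero column appended, where the two halves `a`, `b` of
a column are encoded by the vector `a`; the second half is then `b = w • a`. -/
def evenCol (w : F4) (G : Matrix ρ ι F4) : Option (ι ⊕ ι ⊕ ι) → ρ → F4
  | none => 0
  | some (.inl j) => fun r => G r j
  | some (.inr (.inl j)) => w • fun r => G r j
  | some (.inr (.inr j)) => w ^ 2 • fun r => G r j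

lemma evenCol_bijective {w : F4} (hw : w ^ 2 + w + 1 = 0) {G : Matrix ρ ι F4}
    (hG : IsSimplexMatrix G) : Function.Bijective (evenCol w G) := by
  have hb := powers_bijective hw
  let sc : ι ⊕ ι ⊕ ι → Fin 4 := Sum.elim (fun _ => 1) (Sum.elim (fun _ => 2) fun _ => 3)
  let ix : ι ⊕ ι ⊕ ι → ι := Sum.elim id (Sum.elim id id)
  have hE : ∀ q, evenCol w G (some q) =
      (![0, 1, w, w ^ 2] : Fin 4 → F4) (sc q) • fun r => G r (ix q) := by
    rintro (j | j | j) <;> simp [evenCol, sc, ix]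
  have ht : ∀ q, (![0, 1, w, w ^ 2] : Fin 4 → F4) (sc q) ≠ 0 := by
    have h0 := root_ne_zero hw
    rintro (j | j | j) <;> simp [sc, h0]
  have h0 : ∀ q, evenCol w G (some q) ≠ 0 := fun q => by
    rw [hE]; exact smul_ne_zero (ht q) (hG.1 _)
  have hpair : ∀ q q', sc q = sc q' → ix q = ix q' → q = q' := by
    rintro (j | j | j) (j' | j' | j') <;> simp [sc, ix]
  constructor
  · rintro (_ | q) (_ | q') h
    · rfl
    · exact absurd h.symm (h0 q')
    · exact absurd h (h0 q)
    · obtain ⟨j, _, hj⟩ := hG.2 _ (h0 q)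
      have hix : ix q = ix q' := by
        rw [hj (ix q) ⟨_, hE q⟩, hj (ix q') ⟨_, h.trans (hE q')⟩]
      rw [hE, hE, hix] at h
      exact congrArg some (hpair _ _ (hb.1 (smul_left_injective _ (hG.1 _) h)) hix)
  · intro v
    by_cases hv : v = 0
    · exact ⟨none, hv.symm⟩
    · obtain ⟨j, ⟨c, hc⟩, _⟩ := hG.2 v hv
      obtain ⟨i, rfl⟩ := hb.2 c
      fin_cases i
      · exact absurd (by simpa using hc) hv
      · exact ⟨some (.inl j), by simpa [evenCol] using hc.symm⟩
      · exact ⟨some (.inr (.inl j)), by simpa [evenCol] using hc.symm⟩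
      · exact ⟨some (.inr (.inr j)), by simpa [evenCol] using hc.symm⟩

/-- A nonzero linear form takes each value equally often, so a translate of it vanishes at exactly a
quarter of all vectors. -/
lemma wt_add_dotProduct {y : ρ → F4} (hy : y ≠ 0) (x : F4) [DecidableEq ρ] [Fintype F4] :
    4 * wt (fun v : ρ → F4 => x + y ⬝ᵥ v) = 3 * 4 ^ Fintype.card ρ := by
  classical
  have h4 : Fintype.card F4 = 4 := by rw [← Nat.card_eq_fintype_card]; exact natCard_F4
  let φ : (ρ → F4) →+ F4 :=
    { toFun := fun v => y ⬝ᵥ v, map_zero' := by simp, map_add' := fun a b => by simp }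
  have hsurj : Function.Surjective φ := by
    intro a
    obtain ⟨r, hr⟩ := Function.ne_iff.1 hy
    refine ⟨Pi.single r ((y r)⁻¹ * a), ?_⟩
    simp only [Pi.zero_apply] at hr
    simp [φ, mul_inv_cancel_left₀ hr]
  have hfib : ∀ a, (Finset.univ.filter fun v => φ v = a).card =
      (Finset.univ.filter fun v => φ v = 0).card := fun a =>
    AddMonoidHom.card_fiber_eq_of_mem_range φ (hsurj a) (hsurj 0)
  have htot : Fintype.card (ρ → F4) = 4 ^ Fintype.card ρ := by
    rw [← h4, ← Fintype.card_fun]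
  have hsum := Finset.card_eq_sum_card_fiberwise (f := φ) (s := Finset.univ) (t := Finset.univ)
    (by simp)
  rw [Finset.sum_congr rfl fun a _ => hfib a, Finset.sum_const, Finset.card_univ,
    Finset.card_univ, h4, htot, smul_eq_mul] at hsum
  have hwt : wt (fun v : ρ → F4 => x + y ⬝ᵥ v) + (Finset.univ.filter fun v => φ v = -x).card =
      4 ^ Fintype.card ρ := by
    rw [← htot, wt, hammingNorm, add_comm, ← Finset.card_univ,
      ← Finset.card_filter_add_card_filter_not (s := Finset.univ) (fun v => φ v = -x)]
    congr 2
    ext v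
    simp only [Finset.mem_filter, Finset.mem_univ, true_and, ne_eq, φ, AddMonoidHom.coe_mk,
      ZeroHom.coe_mk]
    rw [eq_neg_iff_add_eq_zero, add_comm]
  rw [hfib] at hwt
  omega

/-- The combination with coefficients `(a, b)` of the rows of `evenMatrix w G` is the linear form
with coefficient vector `a + w b`, evaluated at the upper half of the column. -/
lemma encode_evenMatrix {w : F4} (hw : w ^ 2 + w + 1 = 0) (G : Matrix ρ ι F4)
    (u : ρ ⊕ ρ → ZMod 2) (p : Option (ι ⊕ ι ⊕ ι)) :
    encode (addZeroCol (evenMatrix w G)) u p =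
      (fun r => algebraMap (ZMod 2) F4 (u (.inl r)) + algebraMap (ZMod 2) F4 (u (.inr r)) * w) ⬝ᵥ
        evenCol w G p := by
  have h3 := root_cube hw
  simp only [encode, AddMonoidHom.coe_mk, ZeroHom.coe_mk, evalCol, Fintype.sum_sum_type,
    dotProduct, ← Finset.sum_add_distrib, Algebra.smul_def, addZeroCol, Matrix.of_apply]
  refine Finset.sum_congr rfl fun r _ => ?_
  rcases p with _ | j | j | j <;> simp [evenMatrix, evenCol]
  · ring
  · ring
  · linear_combination (-algebraMap (ZMod 2) F4 (u (.inr r)) * G r j) * h3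

lemma wt_add_encode_evenMatrix [Fintype ι] {w : F4} (hw : w ^ 2 + w + 1 = 0) {G : Matrix ρ ι F4}
    (hG : IsSimplexMatrix G) {u : ρ ⊕ ρ → ZMod 2} (hu : u ≠ 0) (x : F4) :
    4 * wt (fun p => x + encode (addZeroCol (evenMatrix w G)) u p) = 3 * 4 ^ Fintype.card ρ := by
  classical
  let _ := Fintype.ofFinite F4
  simp only [encode_evenMatrix hw]
  rw [← wt_add_dotProduct (y := fun r => algebraMap (ZMod 2) F4 (u (.inl r)) +
    algebraMap (ZMod 2) F4 (u (.inr r)) * w) _ x]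
  · exact congrArg _ (wt_comp_bijective (fun v : ρ → F4 => x + _ ⬝ᵥ v) (evenCol_bijective hw hG))
  · intro h
    apply hu
    have hr : ∀ r, u (.inl r) = 0 ∧ u (.inr r) = 0 := fun r => by
      by_contra h'
      exact coords_ne_zero hw h' (congrFun h r)
    ext (r | r)
    · exact (hr r).1
    · exact (hr r).2

lemma card_evenCol [Fintype ι] {w : F4} (hw : w ^ 2 + w + 1 = 0) {G : Matrix ρ ι F4}
    (hG : IsSimplexMatrix G) : Fintype.card (ι ⊕ ι ⊕ ι) + 1 = 4 ^ Fintype.card ρ := by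
  rw [← Fintype.card_option, ← Nat.card_eq_fintype_card,
    Nat.card_congr (Equiv.ofBijective _ (evenCol_bijective hw hG)), Nat.card_fun, natCard_F4,
    Nat.card_eq_fintype_card]

end Even

/-! ### The combined code -/

section Combined
variable {ρ₁ ρ₂ ι₁ ι₂ : Type*} [Fintype ρ₁] [Fintype ρ₂] [Fintype ι₁] [Fintype ι₂]
  (A : Matrix ρ₁ ι₁ F4) (B : Matrix ρ₂ ι₂ F4)

lemma wt_encode_addZeroCol (u : ρ₁ → ZMod 2) :
    wt (encode (addZeroCol A) u) = wt (encode A u) := by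
  rw [wt_option]
  · rfl
  · simp [encode, evalCol, addZeroCol]

open Classical in
/-- The weight can be computed on all pairs of columns, as the deleted pair contributes nothing. -/
lemma msWeight_combinedColumns (u : ρ₁ ⊕ ρ₂ → ZMod 2) :
    msWeight (combinedColumns A B) u =
      wt fun p : Option ι₁ × Option ι₂ => encode (addZeroCol A) (u ∘ Sum.inl) p.1 +
        encode (addZeroCol B) (u ∘ Sum.inr) p.2 := by
  rw [combinedColumns, msWeight_columns]
  refine Eq.trans ?_ (@wt_subtype _ _ (fun p => p ≠ (none, none)) _ _ ?_)
  · congr 1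
    ext p
    simp only [encode, AddMonoidHom.coe_mk, ZeroHom.coe_mk]
    rw [evalCol_sumElim]
    rfl
  · intro p hp
    rw [not_not.1 hp]
    simp [encode, evalCol, addZeroCol]

/-- If only the upper rows are combined, each column of the upper matrix counts once for every
column of the lower one, the zero column included. -/
lemma msWeight_combinedColumns_left {u : ρ₁ ⊕ ρ₂ → ZMod 2} (hu : u ∘ Sum.inr = 0) :
    msWeight (combinedColumns A B) u =
      (Fintype.card ι₂ + 1) * wt (encode A (u ∘ Sum.inl)) := by
  rw [msWeight_combinedColumns, hu, wt_prod_right, ← wt_encode_addZeroCol]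
  simp

/-- If all translates of the lower part of the combination have the same weight `e`, the upper part
does not matter. -/
lemma msWeight_combinedColumns_right {u : ρ₁ ⊕ ρ₂ → ZMod 2} {e : ℕ}
    (h : ∀ x, wt (fun p => x + encode (addZeroCol B) (u ∘ Sum.inr) p) = e) :
    msWeight (combinedColumns A B) u = (Fintype.card ι₁ + 1) * e := by
  rw [msWeight_combinedColumns, wt_prod]
  simp [h]

lemma msWeight_upperColumns (u : ρ₁ ⊕ ρ₂ → ZMod 2) :
    msWeight (upperColumns ρ₂ A) u = wt (encode A (u ∘ Sum.inl)) := by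
  rw [upperColumns, msWeight_columns]
  congr 1
  ext j
  simp [encode, evalCol]

lemma msWeight_lowerColumns (u : ρ₁ ⊕ ρ₂ → ZMod 2) :
    msWeight (lowerColumns ρ₁ B) u = wt (encode B (u ∘ Sum.inr)) := by
  rw [lowerColumns, msWeight_columns]
  congr 1
  ext j
  simp [encode, evalCol]

omit [Fintype ρ₁] [Fintype ρ₂] in
lemma card_combinedColumns : Multiset.card (combinedColumns A B) + 1 =
    (Fintype.card ι₁ + 1) * (Fintype.card ι₂ + 1) := by
  classical
  rw [combinedColumns, card_columns, ← Fintype.card_option (α := ι₁),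
    ← Fintype.card_option (α := ι₂), ← Fintype.card_prod, Fintype.card_subtype_compl,
    Fintype.card_subtype_eq]
  exact Nat.sub_add_cancel Fintype.card_pos

omit [Fintype ρ₁] [Fintype ρ₂] in
lemma upperColumns_add_lowerColumns_le :
    upperColumns ρ₂ A + lowerColumns ρ₁ B ≤ combinedColumns A B := by
  classical
  let e : ι₁ ⊕ ι₂ → {p : Option ι₁ × Option ι₂ // p ≠ (none, none)} :=
    Sum.elim (fun i => ⟨(some i, none), by simp⟩) fun j => ⟨(none, some j), by simp⟩
  have he : Function.Injective e := by
    rintro (i | i) (j | j) h <;> simp_all [e]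
  have h1 : upperColumns ρ₂ A + lowerColumns ρ₁ B =
      (Finset.univ.val.map e).map fun p r => combined A B r p := by
    rw [Multiset.map_map, ← Finset.univ_disjSum_univ]
    simp [Finset.disjSum, Multiset.disjSum, upperColumns, lowerColumns, columns,
      Multiset.map_map]
    congr 1
    · refine Multiset.map_congr rfl fun i _ => ?_
      ext (r | r) <;> simp [e, combined, star, addZeroCol]
    · refine Multiset.map_congr rfl fun i _ => ?_
      ext (r | r) <;> simp [e, combined, star, addZeroCol]
  rw [h1, combinedColumns, columns]
  refine Multiset.map_le_map ((Multiset.le_iff_subset ?_).2 ?_)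
  · exact Finset.univ.nodup.map he
  · exact fun p _ => Finset.mem_univ p

end Combined

/-! ### The Griesmer bound -/

section Griesmer

/-- Rounding up in two stages, `⌈d / 2 ^ (i + 1)⌉ = ⌈⌈d / 2⌉ / 2 ^ i⌉`. -/
lemma ceil_half_div (d i : ℕ) :
    ⌈(d : ℚ) / 2 ^ (i + 1)⌉₊ = ⌈(((d + 1) / 2 : ℕ) : ℚ) / 2 ^ i⌉₊ := by
  have hp : (0 : ℚ) < 2 ^ i := by positivity
  refine eq_of_forall_ge_iff fun c => ?_
  rw [Nat.ceil_le, Nat.ceil_le, div_le_iff₀ (by positivity), div_le_iff₀ hp, pow_succ]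
  norm_cast
  rw [← mul_assoc]
  omega

lemma griesmer_succ (κ d : ℕ) : griesmer (κ + 1) d = d + griesmer κ ((d + 1) / 2) := by
  rw [griesmer, Finset.sum_range_succ', add_comm, griesmer]
  congr 1
  · simp
  · exact Finset.sum_congr rfl fun i _ => ceil_half_div d i

/-- The Griesmer bound for binary linear codes, given as a family `s` of functionals on the message
space `V`. The induction step passes to the residual code: `V` is cut down to a complement of a
vector `c` of least weight, and the family to the functionals that vanish at `c`. -/
theorem griesmer_le_card {ι : Type*} (κ : ℕ) : ∀ {V : Type*} [AddCommGroup V] [Module (ZMod 2) V]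
    [FiniteDimensional (ZMod 2) V] (φ : ι → V →ₗ[ZMod 2] ZMod 2) (s : Finset ι) (d : ℕ),
    Module.finrank (ZMod 2) V = κ →
    (∀ v ≠ 0, d ≤ (s.filter fun i => φ i v ≠ 0).card) → griesmer κ d ≤ s.card := by
  induction κ with
  | zero => intros; simp [griesmer]
  | succ κ ih =>
    intro V _ _ _ φ s d hV h
    have : Nontrivial V := Module.nontrivial_of_finrank_pos (R := ZMod 2) (by omega)
    obtain ⟨c, hc0, hc⟩ : ∃ c : V, c ≠ 0 ∧ ∀ v ≠ 0, (s.filter fun i => φ i c ≠ 0).card ≤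
        (s.filter fun i => φ i v ≠ 0).card := by
      obtain ⟨x, hx⟩ := exists_ne (0 : V)
      exact ⟨Function.argminOn (fun v : V => (s.filter fun i => φ i v ≠ 0).card) {v | v ≠ 0}
        ⟨x, hx⟩, Function.argminOn_mem _ {v : V | v ≠ 0} _,
        fun v hv => Function.argminOn_le
          (fun v : V => (s.filter fun i => φ i v ≠ 0).card) {v : V | v ≠ 0} hv⟩
    obtain ⟨W, hW⟩ := Submodule.exists_isCompl (Submodule.span (ZMod 2) {c})
    have hWd : Module.finrank (ZMod 2) W = κ := by
      have := Submodule.finrank_add_eq_of_isCompl hW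
      rw [finrank_span_singleton hc0] at this
      omega
    have key := ih (fun i => (φ i).comp W.subtype) (s.filter fun i => φ i c = 0) ((d + 1) / 2) hWd
      (by
        intro v hv
        have hv0 : (v : V) ≠ 0 := by simpa using hv
        have hvc : (v : V) + c ≠ 0 := by
          intro h0
          have : (v : V) ∈ Submodule.span (ZMod 2) {c} := by
            rw [eq_neg_of_add_eq_zero_left h0]
            exact neg_mem (Submodule.mem_span_singleton_self c)
          exact hv0 ((Submodule.disjoint_def.1 hW.disjoint) _ this v.2)
        -- On the support of `c`, the words of `v` and `v + c` are complementary; elsewhere they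
        -- agree.
        have e1 : (s.filter fun i => φ i v ≠ 0).card + (s.filter fun i => φ i (v + c) ≠ 0).card =
            (s.filter fun i => φ i c ≠ 0).card +
              2 * ((s.filter fun i => φ i c = 0).filter
                fun i => (φ i).comp W.subtype v ≠ 0).card := by
          simp only [Finset.card_filter, Finset.filter_filter, ← Finset.sum_add_distrib,
            Finset.mul_sum]
          refine Finset.sum_congr rfl fun i _ => ?_
          simp only [map_add, LinearMap.comp_apply, Submodule.subtype_apply]
          rcases zmod_two_cases (φ i v) with hx | hx <;>
            rcases zmod_two_cases (φ i c) with hy | hy <;> simp [hx, hy, CharTwo.add_self_eq_zero]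
        have h1 := hc _ hv0
        have h2 := hc _ hvc
        have h3 := h _ hc0
        omega)
    have h3 := h _ hc0
    have h4 := Finset.card_filter_add_card_filter_not (s := s) (fun i => φ i c = 0)
    rw [griesmer_succ]
    simp only [ne_eq] at *
    omega

open Classical in
/-- The three nonzero functionals of `F4` over its prime field: they encode the binary simplex code
of length three, in which every nonzero word has weight two. -/
lemma exists_functionals_F4 : ∃ T : Fin 3 → F4 →ₗ[ZMod 2] ZMod 2, ∀ a ≠ 0,
    (Finset.univ.filter fun t => T t a ≠ 0).card = 2 := by
  have hf : Module.finrank (ZMod 2) F4 = 2 := GaloisField.finrank 2 (by norm_num)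
  let e : F4 ≃ₗ[ZMod 2] (Fin 2 → ZMod 2) :=
    (Module.finBasisOfFinrankEq (ZMod 2) F4 hf).equivFun
  let p : Fin 2 → F4 →ₗ[ZMod 2] ZMod 2 := fun i => (LinearMap.proj i).comp e.toLinearMap
  refine ⟨![p 0, p 1, p 0 + p 1], fun a ha => ?_⟩
  have h0 : e a ≠ 0 := by simpa using ha
  have h1 : e a 0 ≠ 0 ∨ e a 1 ≠ 0 := by
    by_contra! h
    exact h0 (by ext i; fin_cases i <;> simp [h])
  rw [Finset.card_filter, Fin.sum_univ_three]
  simp [p]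
  rcases zmod_two_cases (e a 0) with hx | hx <;>
    rcases zmod_two_cases (e a 1) with hy | hy <;> simp_all [CharTwo.add_self_eq_zero]

/-- The Griesmer bound for additive codes over `F4`, by concatenation with the binary simplex code
of length three. -/
theorem HasParams.griesmer_le {ι : Type*} [Fintype ι] {C : AddSubgroup (ι → F4)} {n κ d : ℕ}
    (h : HasParams C n κ d) : griesmer κ (2 * d) ≤ 3 * n := by
  classical
  obtain ⟨T, hT⟩ := exists_functionals_F4
  let V : Submodule (ZMod 2) (ι → F4) := AddSubgroup.toZModSubmodule 2 C
  have hV : Module.finrank (ZMod 2) V = κ := by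
    have h1 : Nat.card V = 2 ^ κ := h.card
    have h2 := Module.natCard_eq_pow_finrank (K := ZMod 2) (V := V)
    rw [h1, Nat.card_zmod] at h2
    exact (Nat.pow_right_injective le_rfl h2).symm
  have := griesmer_le_card κ (V := V)
    (fun p : ι × Fin 3 => (T p.2).comp ((LinearMap.proj p.1).comp V.subtype)) Finset.univ (2 * d) hV
    (by
      intro v hv
      have hv0 : (v : ι → F4) ≠ 0 := by simpa using hv
      have h1 : d ≤ wt (v : ι → F4) := h.minWeight.2 ⟨v, v.2, hv0, rfl⟩
      have h3 : (Finset.univ.filter fun p : ι × Fin 3 =>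
          (T p.2).comp ((LinearMap.proj p.1).comp V.subtype) v ≠ 0).card =
          ∑ j, (Finset.univ.filter fun t => T t ((v : ι → F4) j) ≠ 0).card := by
        simp_rw [Finset.card_filter]
        rw [Fintype.sum_prod_type]
        rfl
      rw [h3]
      have h2 : ∀ j : ι, (Finset.univ.filter fun t => T t ((v : ι → F4) j) ≠ 0).card =
          if (v : ι → F4) j ≠ 0 then 2 else 0 := by
        intro j
        split_ifs with hj
        · exact hT _ hj
        · simp [not_not.1 hj]
      rw [Finset.sum_congr rfl fun j _ => h2 j, ← Finset.sum_filter, Finset.sum_const, smul_eq_mul,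
        mul_comm]
      refine Nat.mul_le_mul_right _ (h1.trans_eq ?_)
      rw [wt, hammingNorm])
  simpa [h.length, mul_comm] using this

end Griesmer

/-- The nonexistence condition in puncture-optimality follows from the numerical one by the Griesmer
bound. -/
lemma IsGPO.of_lt {ι : Type*} [Fintype ι] {D : AddSubgroup (ι → F4)} {n κ d : ℕ}
    (h : HasParams D n κ d) (hg : 3 * n + 3 < griesmer κ (2 * d + 2)) : IsGPO D n κ d := by
  refine ⟨h, hg, ?_⟩
  rintro ⟨C', hC'⟩
  have := hC'.griesmer_le
  rw [show 2 * (d + 1) = 2 * d + 2 by ring] at this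
  omega

/-! ### Values of the Griesmer function -/

section GriesmerBounds

lemma griesmer_three_mul (c : ℕ) : 3 * 2 ^ (c + 1) ≤ griesmer (c + 1) (3 * 2 ^ c) + 3 := by
  induction c with
  | zero => rw [griesmer_succ]; simp
  | succ c ih =>
    rw [griesmer_succ, show (3 * 2 ^ (c + 1) + 1) / 2 = 3 * 2 ^ c by rw [pow_succ]; omega]
    rw [pow_succ 2 (c + 1)]
    omega

lemma griesmer_three_mul_sub_one (c : ℕ) {d : ℕ} (hd : d + 1 = 3 * 2 ^ (c + 1)) :
    3 * 2 ^ (c + 2) ≤ griesmer (c + 2) d + 4 := by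
  have h := griesmer_three_mul c
  rw [griesmer_succ, show (d + 1) / 2 = 3 * 2 ^ c by rw [pow_succ] at hd; omega]
  rw [pow_succ 2 (c + 1)]
  omega

lemma griesmer_three_mul_sub_two (c : ℕ) {d : ℕ} (hd : d + 2 = 3 * 2 ^ (c + 2)) :
    3 * 2 ^ (c + 3) ≤ griesmer (c + 3) d + 6 := by
  have h := griesmer_three_mul_sub_one c (d := (d + 1) / 2) (by rw [pow_succ] at hd; omega)
  rw [griesmer_succ, pow_succ 2 (c + 2)]
  omega

lemma griesmer_three_mul_sub_three (c : ℕ) {d : ℕ} (hd : d + 3 = 3 * 2 ^ (c + 2)) :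
    3 * 2 ^ (c + 3) ≤ griesmer (c + 3) d + 7 := by
  have h := griesmer_three_mul_sub_one c (d := (d + 1) / 2)
    (by rw [pow_succ _ (c + 1)] at hd; omega)
  rw [griesmer_succ, pow_succ 2 (c + 2)]
  omega

lemma griesmer_three_mul_sub_pow (c e : ℕ) : ∀ {d : ℕ}, d + 3 * 2 ^ e = 3 * 2 ^ (c + e + 2) →
    3 * 2 ^ (c + e + 3) ≤ griesmer (c + e + 3) d + (3 * 2 ^ (e + 1) + 1) := by
  induction e with
  | zero => intro d hd; exact griesmer_three_mul_sub_three c (by simpa using hd)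
  | succ e ih =>
    intro d hd
    have e1 : c + (e + 1) + 2 = c + e + 2 + 1 := by ring
    have e2 : c + (e + 1) + 3 = c + e + 3 + 1 := by ring
    rw [e1] at hd
    have h := ih (d := (d + 1) / 2) (by rw [pow_succ, pow_succ] at hd; omega)
    have e3 : c + e + 3 = c + e + 2 + 1 := rfl
    rw [e2, griesmer_succ, pow_succ 2 (c + e + 3), pow_succ 2 (e + 1)]
    rw [← e3] at hd
    omega

/-- Iterating `d ↦ ⌈d / 2⌉` on `d = 3 * 2 ^ (c + j) + 1 - t * 2 ^ j`: the summand `1` is reproduced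
by rounding up, and each step gains one in the Griesmer sum. -/
lemma griesmer_of_halving {t q c : ℕ}
    (base : ∀ d, d + t = 3 * 2 ^ c + 1 → 3 * 2 ^ (c + 1) + q ≤ griesmer (c + 1) d + 2 * t)
    (j : ℕ) : ∀ d, d + t * 2 ^ j = 3 * 2 ^ (c + j) + 1 →
      3 * 2 ^ (c + j + 1) + (q + j) ≤ griesmer (c + j + 1) d + 2 * (t * 2 ^ j) := by
  induction j with
  | zero => simpa using base
  | succ j ih =>
    intro d hd
    have e1 : c + (j + 1) = c + j + 1 := rfl
    rw [e1] at hd ⊢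
    rw [show t * 2 ^ (j + 1) = t * 2 ^ j * 2 by ring] at hd ⊢
    have h := ih ((d + 1) / 2) (by rw [pow_succ] at hd; omega)
    rw [griesmer_succ, pow_succ 2 (c + j + 1)]
    omega

/-- The sequence of halvings with the initial value `d`, whose first half is of the form treated
in `griesmer_of_halving`. -/
lemma griesmer_ge {t q c : ℕ}
    (base : ∀ d, d + t = 3 * 2 ^ c + 1 → 3 * 2 ^ (c + 1) + q ≤ griesmer (c + 1) d + 2 * t)
    (j d : ℕ) (hd : d + 2 * (t * 2 ^ j) = 3 * 2 ^ (c + j + 1) + 2) :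
    3 * 2 ^ (c + j + 2) + (q + j + 2) ≤ griesmer (c + j + 2) d + 4 * (t * 2 ^ j) := by
  have h := griesmer_of_halving base j ((d + 1) / 2) (by rw [pow_succ] at hd; omega)
  rw [griesmer_succ, pow_succ 2 (c + j + 1)]
  omega

/-- The start of the halving argument for a single removed anticode. -/
lemma griesmer_base_one (c d : ℕ) (hd : d + 3 = 3 * 2 ^ (c + 2) + 1) :
    3 * 2 ^ (c + 2 + 1) + 0 ≤ griesmer (c + 2 + 1) d + 2 * 3 :=
  griesmer_three_mul_sub_two c (by omega)

/-- The start of the halving argument for two anticodes whose dimensions differ by one; here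
`9 = 3 + 3 * 2 ^ 1`. -/
lemma griesmer_base_adjacent (c d : ℕ) (hd : d + 9 = 3 * 2 ^ (c + 4) + 1) :
    3 * 2 ^ (c + 4 + 1) + 0 ≤ griesmer (c + 4 + 1) d + 2 * 9 := by
  have h := griesmer_three_mul_sub_two c (d := ((d + 1) / 2 + 1) / 2)
    (by rw [pow_succ, pow_succ] at hd; omega)
  have e1 : 2 ^ (c + 5) = 4 * 2 ^ (c + 3) := by ring
  have e2 : 2 ^ (c + 4) = 2 * 2 ^ (c + 3) := by ring
  rw [griesmer_succ, griesmer_succ, show c + 4 + 1 = c + 5 from rfl, e1]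
  omega

/-- The start of the halving argument for two anticodes whose dimensions differ by `e + 2`. -/
lemma griesmer_base_far (c e d : ℕ) (hd : d + (3 + 3 * 2 ^ (e + 2)) = 3 * 2 ^ (c + e + 4) + 1) :
    3 * 2 ^ (c + e + 4 + 1) + 2 ≤ griesmer (c + e + 4 + 1) d + 2 * (3 + 3 * 2 ^ (e + 2)) := by
  have e1 : 2 ^ (c + e + 5) = 4 * 2 ^ (c + e + 3) := by ring
  have e2 : 2 ^ (c + e + 4) = 2 * 2 ^ (c + e + 3) := by ring
  have e3 : 2 ^ (c + e + 3) = 2 * 2 ^ (c + e + 2) := by ring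
  have e4 : 2 ^ (e + 2) = 4 * 2 ^ e := by ring
  have e5 : 2 ^ (e + 1) = 2 * 2 ^ e := by ring
  have h := griesmer_three_mul_sub_pow c e (d := ((d + 1) / 2 + 1) / 2) (by omega)
  rw [griesmer_succ, griesmer_succ, show c + e + 4 + 1 = c + e + 5 from rfl]
  omega

end GriesmerBounds

/-- The Griesmer function at `2 d + 2`, for the minimum distance `d` left when the anticode of
dimension `k₁` is removed. Since the length is `n = 16 R - 4 P`, the bound reads
`3 n + k₁ ≤ griesmer (k₁ + k₂) (2 d + 2)`. -/
lemma griesmer_removeOne {k₁ k₂ P Q R d : ℕ} (h₁ : 2 ≤ k₁) (h₂ : 2 ≤ k₂) (hP : P = 2 ^ (k₁ - 2))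
    (hQ : Q = 2 ^ (k₂ - 2)) (hR : R = P * Q) (hd : d + 3 * P = 12 * R) :
    48 * R + k₁ ≤ griesmer (k₁ + k₂) (2 * d + 2) + 12 * P := by
  obtain ⟨j, rfl⟩ := Nat.exists_eq_add_of_le' h₁
  obtain ⟨c, rfl⟩ := Nat.exists_eq_add_of_le' h₂
  simp only [Nat.add_sub_cancel] at hP hQ
  have e : 2 ^ (c + 2 + j + 1) = 8 * R := by rw [hR, hP, hQ]; ring
  have h := griesmer_ge (griesmer_base_one c) j (2 * d + 2) (by rw [e, ← hP]; omega)
  rw [← hP, show c + 2 + j + 2 = j + 2 + (c + 2) by ring,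
    show 2 ^ (j + 2 + (c + 2)) = 16 * R by rw [hR, hP, hQ]; ring] at h
  omega

/-- The Griesmer function at `2 d + 2`, for the minimum distance `d` left when both anticodes are
removed. With the length `n = 16 R - 4 P - 4 Q + 1` this bounds the function below by
`3 n + a - 3` if `b = a + 1`, and by `3 n + a - 1` otherwise. -/
lemma griesmer_removeBoth {a b P Q R d : ℕ} (ha : 3 ≤ a) (hab : a < b) (hodd : Odd (b - a))
    (hP : P = 2 ^ (a - 2)) (hQ : Q = 2 ^ (b - 2)) (hR : R = P * Q)
    (hd : d + 3 * P + 3 * Q = 12 * R) :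
    48 * R + a + (if b - a = 1 then 0 else 2) ≤
      griesmer (a + b) (2 * d + 2) + 12 * P + 12 * Q := by
  obtain ⟨j, rfl⟩ := Nat.exists_eq_add_of_le' (show 2 ≤ a by omega)
  simp only [Nat.add_sub_cancel] at hP
  have e : 2 ^ (b + j + 1) = 8 * R := by
    rw [hR, hP, hQ, show b + j + 1 = 3 + j + (b - 2) by omega]; ring
  have e2 : 2 ^ (b + j + 2) = 16 * R := by rw [pow_succ, e]; ring
  obtain ⟨t, q, ht, hq, base⟩ : ∃ t q, t * P = 3 * P + 3 * Q ∧
      (if b - (j + 2) = 1 then 0 else 2) = q ∧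
      ∀ d, d + t = 3 * 2 ^ b + 1 → 3 * 2 ^ (b + 1) + q ≤ griesmer (b + 1) d + 2 * t := by
    split_ifs with h1
    · obtain ⟨c, rfl⟩ := Nat.exists_eq_add_of_le' (show 4 ≤ b by omega)
      refine ⟨9, 0, ?_, rfl, griesmer_base_adjacent c⟩
      have : Q = 2 * P := by rw [hP, hQ, show c + 4 - 2 = j + 1 by omega]; ring
      omega
    · obtain ⟨e, he⟩ := Nat.exists_eq_add_of_le' (show 2 ≤ b - (j + 2) by
        obtain ⟨r, hr⟩ := hodd; omega)
      obtain ⟨c, hc⟩ := Nat.exists_eq_add_of_le' (show e + 4 ≤ b by omega)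
      refine ⟨3 + 3 * 2 ^ (e + 2), 2, ?_, rfl, ?_⟩
      · rw [hP, hQ, show b - 2 = e + 2 + j by omega]; ring
      · rw [hc, ← add_assoc]; exact griesmer_base_far c e
  have h := griesmer_ge base j (2 * d + 2) (by rw [e, ← hP, ht]; omega)
  rw [← hP, ht, e2, show b + j + 2 = j + 2 + b by ring] at h
  rw [hq]
  omega

/-! ### Codes whose weights depend on the support in two blocks of rows -/

section WeightDistribution
variable {ρ₁ ρ₂ : Type*} [Fintype ρ₁] [Fintype ρ₂]

lemma card_compl_zero (ρ : Type*) [Fintype ρ] [DecidableEq ρ] :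
    ({0}ᶜ : Finset (ρ → ZMod 2)).card = 2 ^ Fintype.card ρ - 1 := by
  rw [Finset.card_compl]; simp

variable {ι : Type*} [Fintype ι] {B : Matrix (ρ₁ ⊕ ρ₂) ι F4} {x y z : ℕ}
  (hxy : x ≤ y) (hxz : x ≤ z)
  (hx : ∀ u, u ∘ Sum.inl ≠ 0 → u ∘ Sum.inr ≠ 0 → wt (encode B u) = x)
  (hy : ∀ u, u ∘ Sum.inl ≠ 0 → u ∘ Sum.inr = 0 → wt (encode B u) = y)
  (hz : ∀ u, u ∘ Sum.inl = 0 → u ∘ Sum.inr ≠ 0 → wt (encode B u) = z)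
include hxy hxz hx hy hz

lemma le_wt_of_weights {u : ρ₁ ⊕ ρ₂ → ZMod 2} (hu : u ≠ 0) : x ≤ wt (encode B u) := by
  by_cases h1 : u ∘ Sum.inl = 0 <;> by_cases h2 : u ∘ Sum.inr = 0
  · refine absurd (funext fun i => ?_) hu
    rcases i with i | i
    · exact congrFun h1 i
    · exact congrFun h2 i
  · rwa [hz u h1 h2]
  · rwa [hy u h1 h2]
  · rw [hx u h1 h2]

lemma hasParams_of_weights [Nonempty ρ₁] [Nonempty ρ₂] (hx0 : 0 < x) :
    HasParams (rowCode B) (Fintype.card ι) (Fintype.card ρ₁ + Fintype.card ρ₂) x := by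
  rw [← Fintype.card_sum]
  refine hasParams_rowCode hx0 (fun u hu => le_wt_of_weights hxy hxz hx hy hz hu)
    ⟨fun _ => 1, hx _ ?_ ?_⟩
  · exact fun h => one_ne_zero (congrFun h (Classical.arbitrary ρ₁))
  · exact fun h => one_ne_zero (congrFun h (Classical.arbitrary ρ₂))

lemma weightDistribution_of_weights (hx0 : 0 < x) :
    weightDistribution (rowCode B) =
      1 + C ((2 ^ Fintype.card ρ₁ - 1) * (2 ^ Fintype.card ρ₂ - 1)) * X ^ x +
        C (2 ^ Fintype.card ρ₁ - 1) * X ^ y + C (2 ^ Fintype.card ρ₂ - 1) * X ^ z := by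
  classical
  rw [weightDistribution_rowCode
    fun u hu => hx0.trans_le (le_wt_of_weights hxy hxz hx hy hz hu),
    ← (Equiv.sumArrowEquivProdArrow ρ₁ ρ₂ (ZMod 2)).symm.sum_comp, Fintype.sum_prod_type,
    Fintype.sum_eq_add_sum_compl 0, Fintype.sum_eq_add_sum_compl 0]
  have hx' : ∀ a b, a ≠ 0 → b ≠ 0 →
      wt (encode B ((Equiv.sumArrowEquivProdArrow ρ₁ ρ₂ (ZMod 2)).symm (a, b))) = x :=
    fun a b ha hb => hx _ ha hb
  have hy' : ∀ a, a ≠ 0 →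
      wt (encode B ((Equiv.sumArrowEquivProdArrow ρ₁ ρ₂ (ZMod 2)).symm (a, 0))) = y :=
    fun a ha => hy _ ha rfl
  have hz' : ∀ b, b ≠ 0 →
      wt (encode B ((Equiv.sumArrowEquivProdArrow ρ₁ ρ₂ (ZMod 2)).symm (0, b))) = z :=
    fun b hb => hz _ rfl hb
  have h0 : wt (encode B ((Equiv.sumArrowEquivProdArrow ρ₁ ρ₂ (ZMod 2)).symm (0, 0))) = 0 := by
    rw [wt_eq_zero]
    convert map_zero (encode B)
    ext (i | i) <;> rfl
  have h1 : ∀ v ∈ ({0}ᶜ : Finset (ρ₂ → ZMod 2)),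
      (X : ℕ[X]) ^ wt (encode B ((Equiv.sumArrowEquivProdArrow ρ₁ ρ₂ (ZMod 2)).symm (0, v))) =
        X ^ z := fun v hv => by
    rw [hz' _ (show v ≠ 0 by simpa using hv)]
  have h2 : ∀ u ∈ ({0}ᶜ : Finset (ρ₁ → ZMod 2)), ∑ v : ρ₂ → ZMod 2,
      (X : ℕ[X]) ^ wt (encode B ((Equiv.sumArrowEquivProdArrow ρ₁ ρ₂ (ZMod 2)).symm (u, v))) =
        X ^ y + (2 ^ Fintype.card ρ₂ - 1) • X ^ x := fun u hu => by
    rw [Fintype.sum_eq_add_sum_compl 0, hy' _ (by simpa using hu),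
      Finset.sum_congr rfl fun v hv => by
        rw [hx' _ _ (show u ≠ 0 by simpa using hu) (show v ≠ 0 by simpa using hv)],
      Finset.sum_const, card_compl_zero]
  rw [h0, Finset.sum_congr rfl h1, Finset.sum_congr rfl h2, Finset.sum_const, Finset.sum_const,
    card_compl_zero, card_compl_zero]
  simp only [nsmul_eq_mul, C_mul, pow_zero, ← C_eq_natCast]
  simp only [Nat.cast_id]
  ring

end WeightDistribution

lemma isWeightCode_of_weightDistribution {ι : Type*} [Fintype ι] {C' : AddSubgroup (ι → F4)}
    (T : Finset ℕ) (a : ℕ → ℕ) (hT : ∀ i ∈ T, 1 ≤ i ∧ i ≤ Fintype.card ι) (ha : ∀ i ∈ T, a i ≠ 0)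
    (h : weightDistribution C' = 1 + ∑ i ∈ T, C (a i) * X ^ i) :
    IsWeightCode C' T.card := by
  rw [IsWeightCode, ← Set.ncard_coe_finset]
  congr 1
  ext i
  have hcoeff : 1 ≤ i → (weightDistribution C').coeff i = if i ∈ T then a i else 0 := by
    intro hi
    have h0 : i ≠ 0 := by omega
    simp [h, coeff_one, h0, coeff_X_pow]
  constructor
  · rintro ⟨h1, h2, h3⟩
    rw [numWords_eq_coeff _ h1 h2, hcoeff h1] at h3
    by_contra hi
    exact h3 (if_neg hi)
  · intro hi
    refine ⟨(hT i hi).1, (hT i hi).2, ?_⟩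
    rw [numWords_eq_coeff _ (hT i hi).1 (hT i hi).2, hcoeff (hT i hi).1,
      if_pos (Finset.mem_coe.1 hi)]
    exact ha i hi

end QuaternaryAdditive

end

open QuaternaryAdditive Polynomial in
theorem mainTheorem4
    (w : F4) (hw : w ^ 2 + w + 1 = 0)
    (S : Matrix (Fin 3) (Fin 7) (ZMod 2)) (hS : IsSimplexMatrix S)
    (f : (ZMod 2)[X]) (hf_monic : f.Monic) (hf_irr : Irreducible f) (hf_deg : f.natDegree = 3)
    (m l s : ℕ) (hl : 2 ≤ l)
    (G : Matrix (Fin l) (Fin s) F4) (hG : IsSimplexMatrix G)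
    (A₁ : Matrix (OddRow m) (OddCol m) F4) (hA₁ : A₁ = oddMatrix w (apsMatrix w f S) m)
    (A₂ : Matrix (Fin l ⊕ Fin l) (Fin s ⊕ Fin s ⊕ Fin s) F4) (hA₂ : A₂ = evenMatrix w G)
    (L L₁ L₂ : Multiset (OddRow m ⊕ (Fin l ⊕ Fin l) → F4))
    (hL : L = combinedColumns A₁ A₂)
    (hL₁ : L₁ = upperColumns (Fin l ⊕ Fin l) A₁)
    (hL₂ : L₂ = lowerColumns (OddRow m) A₂)
    (k₁ k₂ k : ℕ) (hk₁ : k₁ = 2 * m + 3) (hk₂ : k₂ = 2 * l) (hk : k = k₁ + k₂) :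
    L₁ + L₂ ≤ L ∧
    (∀ (n : ℕ) (B : Matrix (OddRow m ⊕ (Fin l ⊕ Fin l)) (Fin n) F4),
      columns B = remove L L₁ →
        HasParams (rowCode B) (2 ^ k - 2 ^ k₁) k (3 * 2 ^ (k - 2) - 3 * 2 ^ (k₁ - 2)) ∧
        IsWeightCode (rowCode B) 2 ∧
        weightDistribution (rowCode B) =
          1 + C (2 ^ k - 2 ^ k₂) * X ^ (3 * 2 ^ (k - 2) - 3 * 2 ^ (k₁ - 2))
            + C (2 ^ k₂ - 1) * X ^ (3 * 2 ^ (k - 2)) ∧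
        (k₁ = 3 →
          IsGDO (rowCode B) (2 ^ k - 2 ^ k₁) k (3 * 2 ^ (k - 2) - 3 * 2 ^ (k₁ - 2))) ∧
        (5 ≤ k₁ →
          IsGPO (rowCode B) (2 ^ k - 2 ^ k₁) k (3 * 2 ^ (k - 2) - 3 * 2 ^ (k₁ - 2)))) ∧
    (∀ (n : ℕ) (B : Matrix (OddRow m ⊕ (Fin l ⊕ Fin l)) (Fin n) F4),
      columns B = remove L (L₁ + L₂) →
        HasParams (rowCode B) (2 ^ k - 2 ^ k₁ - 2 ^ k₂ + 1) k
          (3 * 2 ^ (k - 2) - 3 * 2 ^ (k₁ - 2) - 3 * 2 ^ (k₂ - 2)) ∧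
        IsWeightCode (rowCode B) 3 ∧
        weightDistribution (rowCode B) =
          1 + C (2 ^ k - 2 ^ k₁ - 2 ^ k₂ + 1) *
                X ^ (3 * 2 ^ (k - 2) - 3 * 2 ^ (k₁ - 2) - 3 * 2 ^ (k₂ - 2))
            + C (2 ^ k₁ - 1) * X ^ (3 * 2 ^ (k - 2) - 3 * 2 ^ (k₁ - 2))
            + C (2 ^ k₂ - 1) * X ^ (3 * 2 ^ (k - 2) - 3 * 2 ^ (k₂ - 2)) ∧
        ((k₁, k₂) ≠ (3, 4) →
          IsGDO (rowCode B) (2 ^ k - 2 ^ k₁ - 2 ^ k₂ + 1) k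
            (3 * 2 ^ (k - 2) - 3 * 2 ^ (k₁ - 2) - 3 * 2 ^ (k₂ - 2))) ∧
        ((|(k₁ : ℤ) - k₂| = 1 ∧ 9 ≤ k ∧ k ≤ 15) ∨ (3 ≤ |(k₁ : ℤ) - k₂| ∧ min k₁ k₂ ≤ 4) →
          IsGDO (rowCode B) (2 ^ k - 2 ^ k₁ - 2 ^ k₂ + 1) k
            (3 * 2 ^ (k - 2) - 3 * 2 ^ (k₁ - 2) - 3 * 2 ^ (k₂ - 2))) ∧
        ((|(k₁ : ℤ) - k₂| = 1 ∧ 17 ≤ k) ∨ (3 ≤ |(k₁ : ℤ) - k₂| ∧ 4 < min k₁ k₂) →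
          IsGPO (rowCode B) (2 ^ k - 2 ^ k₁ - 2 ^ k₂ + 1) k
            (3 * 2 ^ (k - 2) - 3 * 2 ^ (k₁ - 2) - 3 * 2 ^ (k₂ - 2)))) := by
  subst hL hL₁ hL₂ hA₁ hA₂
  set A₁ := oddMatrix w (apsMatrix w f S) m with hA₁
  set A₂ := evenMatrix w G with hA₂
  have hk₁3 : 3 ≤ k₁ := by omega
  have hk₂4 : 4 ≤ k₂ := by omega
  -- All quantities are expressed by `P = 2 ^ (k₁ - 2)`, `Q = 2 ^ (k₂ - 2)` and `R = P * Q`, so that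
  -- the numerical conditions become linear.
  obtain ⟨P, hP⟩ : ∃ P, P = 2 ^ (k₁ - 2) := ⟨_, rfl⟩
  obtain ⟨Q, hQ⟩ : ∃ Q, Q = 2 ^ (k₂ - 2) := ⟨_, rfl⟩
  obtain ⟨R, hR⟩ : ∃ R, R = P * Q := ⟨_, rfl⟩
  have eP : 2 ^ k₁ = 4 * P := by
    rw [hP, show k₁ = k₁ - 2 + 2 by omega, pow_add, Nat.add_sub_cancel]; ring
  have eQ : 2 ^ k₂ = 4 * Q := by
    rw [hQ, show k₂ = k₂ - 2 + 2 by omega, pow_add, Nat.add_sub_cancel]; ring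
  have eR : 2 ^ k = 16 * R := by rw [hk, pow_add, eP, eQ, hR]; ring
  have eR' : 2 ^ (k - 2) = 4 * R := by
    have : 2 ^ k = 2 ^ (k - 2) * 4 := by rw [show k = k - 2 + 2 by omega, pow_add]; rfl
    omega
  have hP2 : 2 ≤ P := by
    rw [hP]; exact Nat.pow_le_pow_right (n := 2) two_pos (show 1 ≤ k₁ - 2 by omega)
  have hQ4 : 4 ≤ Q := by
    rw [hQ]; exact Nat.pow_le_pow_right (n := 2) two_pos (show 2 ≤ k₂ - 2 by omega)
  have hRP : 4 * P ≤ R := by rw [hR, mul_comm]; exact Nat.mul_le_mul_left _ hQ4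
  have hRQ : 2 * Q ≤ R := by rw [hR]; exact Nat.mul_le_mul_right _ hP2
  -- `k₁` is odd and `k₂` is even, so the weights in the three-weight code are distinct.
  have hPQ : P ≠ Q := by
    rw [hP, hQ]
    intro h
    have := Nat.pow_right_injective le_rfl h
    omega
  have e4m : 4 ^ m * 2 = P := by
    rw [hP, show k₁ - 2 = 2 * m + 1 by omega, pow_succ, pow_mul]; rfl
  have e4l : 4 ^ l = 4 * Q := by rw [← eQ, hk₂, pow_mul]; rfl
  have c₁ : Fintype.card (OddCol m) + 1 = 4 * P := by rw [card_oddCol, ← e4m]; ring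
  have c₂ : Fintype.card (Fin s ⊕ Fin s ⊕ Fin s) + 1 = 4 * Q := by
    rw [card_evenCol hw hG, Fintype.card_fin, e4l]
  have r₁ : Fintype.card (OddRow m) = k₁ := by rw [card_oddRow, hk₁]
  have r₂ : Fintype.card (Fin l ⊕ Fin l) = k₂ := by simp [hk₂]; ring
  have : Nonempty (OddRow m) := Fintype.card_pos_iff.1 (by omega)
  have : Nonempty (Fin l ⊕ Fin l) := Fintype.card_pos_iff.1 (by omega)
  have w₁ : ∀ u ≠ 0, wt (encode A₁ u) = 3 * P := fun u hu => by
    rw [wt_encode_oddMatrix hw (wt_encode_apsMatrix hw hS hf_monic hf_irr hf_deg) m u hu, ← e4m]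
    ring
  have w₂' : ∀ u ≠ 0, ∀ x, wt (fun p => x + encode (addZeroCol A₂) u p) = 3 * Q :=
    fun u hu x => by
      have : 4 * wt (fun p => x + encode (addZeroCol A₂) u p) = 3 * 4 ^ Fintype.card (Fin l) :=
        wt_add_encode_evenMatrix hw hG hu x
      rw [Fintype.card_fin, e4l] at this
      omega
  have w₂ : ∀ u ≠ 0, wt (encode A₂ u) = 3 * Q := fun u hu => by
    rw [← wt_encode_addZeroCol]
    simpa using w₂' u hu 0
  have z₁ : wt (encode A₁ 0) = 0 := by rw [map_zero, wt_eq_zero]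
  have z₂ : wt (encode A₂ 0) = 0 := by rw [map_zero, wt_eq_zero]
  have wL : ∀ u, (u ∘ Sum.inl ≠ 0 ∨ u ∘ Sum.inr ≠ 0) →
      msWeight (combinedColumns A₁ A₂) u = 12 * R := by
    intro u hu
    by_cases h : u ∘ Sum.inr = 0
    · rw [msWeight_combinedColumns_left _ _ h, c₂, w₁ _ (hu.resolve_right (not_not.2 h)), hR]; ring
    · rw [msWeight_combinedColumns_right _ _ (w₂' _ h), c₁, hR]; ring
  have hle := upperColumns_add_lowerColumns_le A₁ A₂
  have hle₁ : upperColumns (Fin l ⊕ Fin l) A₁ ≤ combinedColumns A₁ A₂ :=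
    (Multiset.le_add_right _ _).trans hle
  have cL : Multiset.card (combinedColumns A₁ A₂) + 1 = 16 * R := by
    rw [card_combinedColumns, c₁, c₂, hR]; ring
  have cL₁ : Multiset.card (upperColumns (Fin l ⊕ Fin l) A₁) + 1 = 4 * P := by
    rw [upperColumns, card_columns, c₁]
  have cL₂ : Multiset.card (lowerColumns (OddRow m) A₂) + 1 = 4 * Q := by
    rw [lowerColumns, card_columns, c₂]
  refine ⟨hle, fun n B hB => ?_, fun n B hB => ?_⟩
  · have hn : n = 16 * R - 4 * P := by
      have := congrArg Multiset.card hB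
      rw [card_columns, Fintype.card_fin, card_remove hle₁] at this
      omega
    subst hn
    have hw' : ∀ u, wt (encode B u) = msWeight (combinedColumns A₁ A₂) u -
        wt (encode A₁ (u ∘ Sum.inl)) := fun u => by
      rw [← msWeight_columns, hB, msWeight_remove hle₁, msWeight_upperColumns]
    have hx : ∀ u : OddRow m ⊕ (Fin l ⊕ Fin l) → ZMod 2, u ∘ Sum.inl ≠ 0 →
        wt (encode B u) = 12 * R - 3 * P := fun u h => by
      rw [hw', wL u (.inl h), w₁ _ h]
    have hz : ∀ u : OddRow m ⊕ (Fin l ⊕ Fin l) → ZMod 2, u ∘ Sum.inl = 0 → u ∘ Sum.inr ≠ 0 →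
        wt (encode B u) = 12 * R := fun u h h' => by
      rw [hw', wL u (.inr h'), h, z₁, Nat.sub_zero]
    have hpar := hasParams_of_weights (by omega) (by omega) (fun u h _ => hx u h)
      (fun u h _ => hx u h) hz (by omega)
    have hwd := weightDistribution_of_weights (by omega) (by omega) (fun u h _ => hx u h)
      (fun u h _ => hx u h) hz (by omega)
    rw [Fintype.card_fin, r₁, r₂, ← hk] at hpar
    rw [r₁, r₂] at hwd
    have hwd' : weightDistribution (rowCode B) = 1 + C (16 * R - 4 * Q) * X ^ (12 * R - 3 * P) +
        C (4 * Q - 1) * X ^ (12 * R) := by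
      have : 16 * R - 4 * Q = (4 * P - 1) * (4 * Q - 1) + (4 * P - 1) := by
        have h1 : (4 * P - 1) * (4 * Q - 1) + (4 * P - 1) = (4 * P - 1) * (4 * Q) := by
          obtain ⟨a, ha⟩ := Nat.exists_eq_add_of_le' (show 1 ≤ 4 * Q by omega)
          rw [ha, Nat.add_sub_cancel]; ring
        rw [h1, Nat.sub_mul, hR, one_mul]
        congr 1; ring
      rw [hwd, eP, eQ, this, C_add]; ring
    have hg := griesmer_removeOne (by omega) (by omega) hP hQ hR
      (show 12 * R - 3 * P + 3 * P = 12 * R by omega)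
    rw [← hk] at hg
    have e1 : 3 * (4 * R) - 3 * P = 12 * R - 3 * P := by omega
    have e2 : 3 * (4 * R) = 12 * R := by omega
    rw [eR, eR', eP, eQ, ← hP, e1, e2]
    refine ⟨hpar, ?_, hwd', fun h => ⟨hpar, by omega⟩, fun h => .of_lt hpar (by omega)⟩
    have h2 : ({12 * R - 3 * P, 12 * R} : Finset ℕ).card = 2 := Finset.card_pair (by omega)
    rw [← h2]
    refine isWeightCode_of_weightDistribution _
      (fun i => if i = 12 * R then 4 * Q - 1 else 16 * R - 4 * Q) ?_ ?_ ?_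
    · rw [Fintype.card_fin]
      intro i hi
      simp only [Finset.mem_insert, Finset.mem_singleton] at hi
      omega
    · intro i hi
      split_ifs <;> omega
    · rw [Finset.sum_pair (by omega), if_pos rfl, if_neg (by omega), hwd']; ring
  · have hn : n = 16 * R - 4 * P - 4 * Q + 1 := by
      have := congrArg Multiset.card hB
      rw [card_columns, Fintype.card_fin, card_remove hle, Multiset.card_add] at this
      omega
    subst hn
    have hw' : ∀ u, wt (encode B u) = msWeight (combinedColumns A₁ A₂) u -
        (wt (encode A₁ (u ∘ Sum.inl)) + wt (encode A₂ (u ∘ Sum.inr))) := fun u => by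
      rw [← msWeight_columns, hB, msWeight_remove hle, msWeight_add, msWeight_upperColumns,
        msWeight_lowerColumns]
    have hx : ∀ u : OddRow m ⊕ (Fin l ⊕ Fin l) → ZMod 2, u ∘ Sum.inl ≠ 0 → u ∘ Sum.inr ≠ 0 →
        wt (encode B u) = 12 * R - 3 * P - 3 * Q := fun u h h' => by
      rw [hw', wL u (.inl h), w₁ _ h, w₂ _ h', Nat.sub_sub]
    have hy : ∀ u : OddRow m ⊕ (Fin l ⊕ Fin l) → ZMod 2, u ∘ Sum.inl ≠ 0 → u ∘ Sum.inr = 0 →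
        wt (encode B u) = 12 * R - 3 * P := fun u h h' => by
      rw [hw', wL u (.inl h), w₁ _ h, h', z₂, Nat.add_zero]
    have hz : ∀ u : OddRow m ⊕ (Fin l ⊕ Fin l) → ZMod 2, u ∘ Sum.inl = 0 → u ∘ Sum.inr ≠ 0 →
        wt (encode B u) = 12 * R - 3 * Q := fun u h h' => by
      rw [hw', wL u (.inr h'), h, z₁, w₂ _ h', Nat.zero_add]
    have hpar := hasParams_of_weights (by omega) (by omega) hx hy hz (by omega)
    have hwd := weightDistribution_of_weights (by omega) (by omega) hx hy hz (by omega)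
    rw [Fintype.card_fin, r₁, r₂, ← hk] at hpar
    rw [r₁, r₂] at hwd
    have hwd' : weightDistribution (rowCode B) =
        1 + C (16 * R - 4 * P - 4 * Q + 1) * X ^ (12 * R - 3 * P - 3 * Q) +
        C (4 * P - 1) * X ^ (12 * R - 3 * P) + C (4 * Q - 1) * X ^ (12 * R - 3 * Q) := by
      have : 16 * R - 4 * P - 4 * Q + 1 = (4 * P - 1) * (4 * Q - 1) := by
        have h1 : (4 * P - 1) * (4 * Q - 1) + 4 * P + 4 * Q = 16 * R + 1 := by
          obtain ⟨a, ha⟩ := Nat.exists_eq_add_of_le' (show 1 ≤ 4 * Q by omega)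
          obtain ⟨b, hb⟩ := Nat.exists_eq_add_of_le' (show 1 ≤ 4 * P by omega)
          rw [show 16 * R = (4 * P) * (4 * Q) by rw [hR]; ring, ha, hb, Nat.add_sub_cancel,
            Nat.add_sub_cancel]
          ring
        omega
      rw [hwd, eP, eQ, this]
    have hg : 48 * R + min k₁ k₂ + (if |(k₁ : ℤ) - k₂| = 1 then 0 else 2) ≤
        griesmer k (2 * (12 * R - 3 * P - 3 * Q) + 2) + 12 * P + 12 * Q := by
      rcases lt_or_gt_of_ne (show k₁ ≠ k₂ by omega) with h | h
      · have := griesmer_removeBoth hk₁3 h ⟨(k₂ - k₁) / 2, by omega⟩ hP hQ hR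
          (show 12 * R - 3 * P - 3 * Q + 3 * P + 3 * Q = 12 * R by omega)
        rw [← hk] at this
        rw [min_eq_left h.le, abs_of_neg (by omega)]
        split_ifs at this ⊢ <;> omega
      · have := griesmer_removeBoth (by omega) h ⟨(k₁ - k₂) / 2, by omega⟩ hQ hP
          (hR.trans (mul_comm _ _))
          (show 12 * R - 3 * P - 3 * Q + 3 * Q + 3 * P = 12 * R by omega)
        rw [add_comm k₂, ← hk] at this
        rw [min_eq_right h.le, abs_of_pos (by omega)]
        split_ifs at this ⊢ <;> omega
    -- The parities of `k₁` and `k₂` differ, so the remaining cases have difference at least three.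
    have hadj : |(k₁ : ℤ) - k₂| = 1 → k = 2 * min k₁ k₂ + 1 := fun h => by
      rcases (abs_eq zero_le_one).1 h with h | h <;> omega
    have e1 : 3 * (4 * R) - 3 * P - 3 * Q = 12 * R - 3 * P - 3 * Q := by omega
    have e2 : 3 * (4 * R) - 3 * P = 12 * R - 3 * P := by omega
    have e3 : 3 * (4 * R) - 3 * Q = 12 * R - 3 * Q := by omega
    rw [eR, eR', eP, eQ, ← hP, ← hQ, e1, e2, e3]
    refine ⟨hpar, ?_, hwd', fun h => ⟨hpar, ?_⟩, fun h => ⟨hpar, ?_⟩, fun h => .of_lt hpar ?_⟩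
    · have h3 : ({12 * R - 3 * P - 3 * Q, 12 * R - 3 * P, 12 * R - 3 * Q} : Finset ℕ).card = 3 :=
        Finset.card_eq_three.2 ⟨_, _, _, by omega, by omega, by omega, rfl⟩
      rw [← h3]
      refine isWeightCode_of_weightDistribution _
        (fun i => if i = 12 * R - 3 * P then 4 * P - 1 else if i = 12 * R - 3 * Q then 4 * Q - 1
          else 16 * R - 4 * P - 4 * Q + 1) ?_ ?_ ?_
      · rw [Fintype.card_fin]
        intro i hi
        simp only [Finset.mem_insert, Finset.mem_singleton] at hi
        omega
      · intro i hi
        split_ifs <;> omega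
      · rw [Finset.sum_insert (by simp; omega), Finset.sum_pair (by omega), if_neg (by omega),
          if_neg (by omega), if_pos rfl, if_neg (by omega), if_pos rfl, hwd']
        ring
    · split_ifs at hg with h1
      · have := hadj h1
        have h4 : min k₁ k₂ ≠ 3 := fun h3 => h (by rw [Prod.mk.injEq]; omega)
        omega
      · omega
    · split_ifs at hg with h1
      · have := hadj h1
        omega
      · omega
    · split_ifs at hg with h1
      · have := hadj h1
        omega
      · omega
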